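/- Let $s$ be a nonnegative integer and let $Z=(z_n)$ be a (finite or infinite) sequence of nonzero points of the unit disc $\mathbb D=\{|z|<1\}$ with $\sum_n(1-|z_n|)^{s+1}<\infty$. Put $E(w,0)=1-w$, $E(w,q)=(1-w)\exp\{w+w^2/2+\dots+w^q/q\}$ for $q\ge 1$, and let $$P_s(z)=\prod_n E\Bigl(\frac{1-|z_n|^2}{1-\bar z_n z},\,s\Bigr),\qquad B(z)=\prod_n\frac{\bar z_n(z_n-z)}{|z_n|(1-\bar z_nz)}$$ be the Djrbashian–Naftalevich–Tsuji canonical product and (when $s=0$) the Blaschke product of $Z$. For $p\ge1$, $0<r<1$ write $$m_p(r,\log|f|)=\Bigl(\frac1{2\pi}\int_0^{2\pi}\bigl|\log|f(re^{i\theta})|\bigr|^p\,d\theta\Bigr)^{1/p},$$ and for $\varphi\in\mathbb R$, $\delta\in(0,1)$ let $S(\varphi,\delta)=\{\rho e^{i\theta}:1-\delta\le\rho\le1,\ -\pi\delta<\theta-\varphi\le\pi\delta\}$. For $\gamma\in(0,s+1]$ consider the condition $$\sum_{z_n\in S(\varphi,\delta)}(1-|z_n|)^{s+1}\le C_1\delta^\gamma,\qquad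 \delta\in(0,1),\ \varphi\in\mathbb R,\tag{1}$$ for some constant $C_1$ independent of $\varphi$ and $\delta$. (i) If (1) holds, then for every $p\ge1$ there is a constant $C_2>0$ (independent of $r$) such that for all $0<r<1$ $$m_p(r,\log|P_s|)\le\begin{cases}C_2(1-r)^{\gamma-s-1}\bigl(\log\frac1{1-r}+1\bigr),&\gamma\in(0,s+1),\\ C_2\bigl(\log^2(1-r)+1\bigr),&\gamma=s+1.\end{cases}$$ (ii) Let $s=0$, $\gamma\in(0,1]$, and let $\mathcal R\subset(0,1)$ be a set of radii, for example $\mathcal R=(0,1)$, such that for some $q\in(0,1)$ and every $t\in(0,1)$ there is $r\in\mathcal R$ with $qt\le1-r\le t$. If there is a constant $K$ independent of $p$ and $r$ such that $$m_p(r,\log|B|)\le K(1-r)^{\gamma-1}\qquad\text{for all }p\ge1\text{ and all }r\in\mathcal R,$$ then (1) holds (with $s=0$). -/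

import Mathlib

open scoped ENNReal

/-- The elementary factor `E(w, q) = (1 - w) exp (w + w ^ 2 / 2 + ... + w ^ q / q)`;
in particular `E(w, 0) = 1 - w`. -/
noncomputable def elementaryFactor (w : ℂ) (q : ℕ) : ℂ :=
  (1 - w) * Complex.exp (∑ j ∈ Finset.Icc 1 q, w ^ j / (j : ℂ))

/-- The Djrbashian-Naftalevich-Tsuji canonical product `P(ζ, Z, q)` of the (finite or infinite)
sequence `Z = (z n)`. -/
noncomputable def canonicalProduct {ι : Type*} (z : ι → ℂ) (q : ℕ) (ζ : ℂ) : ℂ :=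
  ∏' n, elementaryFactor ((1 - (‖z n‖ : ℂ) ^ 2) / (1 - starRingEnd ℂ (z n) * ζ)) q

/-- The Blaschke product `B(ζ, Z)` of the sequence `Z = (z n)` of nonzero points. -/
noncomputable def blaschkeProduct {ι : Type*} (z : ι → ℂ) (ζ : ℂ) : ℂ :=
  ∏' n, (starRingEnd ℂ (z n) * (z n - ζ)) / ((‖z n‖ : ℂ) * (1 - starRingEnd ℂ (z n) * ζ))

/-- The Carleson square
`S(φ, δ) = {ρ e^{iθ} : 1 - δ ≤ ρ ≤ 1, -πδ < θ - φ ≤ πδ}` (used for `0 < δ < 1`). -/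
def carlesonSquare (φ δ : ℝ) : Set ℂ :=
  {w | ∃ ρ θ : ℝ, 1 - δ ≤ ρ ∧ ρ ≤ 1 ∧ -(Real.pi * δ) < θ - φ ∧ θ - φ ≤ Real.pi * δ ∧
    w = (ρ : ℂ) * Complex.exp ((θ : ℂ) * Complex.I)}

/-- The Carleson-type condition: for some constant `C₁` independent of `φ` and `δ`, the sum of
`(1 - |z n|) ^ (s + 1)` over the terms of the sequence lying in `S(φ, δ)` is at most `C₁ δ ^ γ`. -/
def CarlesonCondition {ι : Type*} (z : ι → ℂ) (s : ℕ) (γ : ℝ) : Prop :=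
  ∃ C₁ : ℝ, ∀ φ δ : ℝ, 0 < δ → δ < 1 →
    ∑' n : {n : ι // z n ∈ carlesonSquare φ δ}, (1 - ‖z n‖) ^ (s + 1) ≤ C₁ * δ ^ γ

/-- The `p`-th integral mean `((1 / 2π) ∫_0^{2π} |log |f(r e^{iθ})|| ^ p dθ) ^ (1 / p)`, as an
element of `[0, ∞]`. -/
noncomputable def logMean (p r : ℝ) (f : ℂ → ℂ) : ℝ≥0∞ :=
  ((∫⁻ θ in Set.Ioc 0 (2 * Real.pi),
      ENNReal.ofReal (|Real.log ‖f ((r : ℂ) * Complex.exp ((θ : ℂ) * Complex.I))‖| ^ p)) /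
    ENNReal.ofReal (2 * Real.pi)) ^ (1 / p)

/-! (i) Write `w n` for the argument of the factor at `z n`. Then `|log|E(w n, s)||` is a weight `|w
n| ^ (s+1)` times a ratio that is bounded except for the singularity of `log|1 - w n|`. The Carleson
condition, applied at each dyadic scale between 1 and `1 - r`, bounds the sum of the weights
pointwise by `M`, of order `(1-r)^(γ-s-1) (log(1/(1-r)) + 1)`
(`exists_tsum_norm_tsujiRatio_pow_le`). Hölder with these weights reduces the `p`-th power of the
whole sum to one factor at a time (`lintegral_tsum_mul_rpow_le`). There the singularity is harmless:
it occurs only if `1 - r ≤ 4(1 - |z|)`, and then its contribution and the mass of the weight both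
compare with `1 - |z|` (`exists_lintegral_near_le`). The `p`-th mean is thus `O(M)`.

(ii) A bound uniform in `p` becomes a pointwise bound as `p → ∞` (`le_of_forall_logMean_le`). On the
arc near `φ`, at a radius with `1 - r` comparable to `δ`, each zero in `S(φ, δ)` adds at least a
constant times `(1 - |z|)/δ` to `-log|B|`, so the sum over the square is `O(δ · δ^(γ-1))`. -/

section

open MeasureTheory

/-! ### Logarithmic size of the elementary factors -/

lemma abs_log_norm_elementaryFactor_le_of_norm_le_half {w : ℂ} (hw : ‖w‖ ≤ 1 / 2) (q : ℕ) :
    |Real.log ‖elementaryFactor w q‖| ≤ 2 * ‖w‖ ^ (q + 1) := by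
  have hlt : ‖-w‖ < 1 := by rw [norm_neg]; linarith
  have hne : 1 - w ≠ 0 := by
    intro h
    have h1 : w = 1 := (sub_eq_zero.1 h).symm
    rw [h1, norm_one] at hw
    norm_num at hw
  -- The exponent cancels the Taylor polynomial of `log (1 - w)`, leaving only the remainder. The `j
  -- = 0` term of `logTaylor` is a division by zero, hence 0.
  have hT : Complex.logTaylor (q + 1) (-w) = -∑ j ∈ Finset.Icc 1 q, w ^ j / (j : ℂ) := by
    rw [Complex.logTaylor, Finset.sum_range_succ', ← Finset.sum_neg_distrib,
      Finset.range_eq_Ico, Finset.sum_Ico_add' (fun j : ℕ => (-1 : ℂ) ^ (j + 1) * (-w) ^ j / (j : ℂ))]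
    simp only [Nat.cast_zero, div_zero, add_zero, zero_add]
    refine Finset.sum_congr (by ext; simp) fun j _ => ?_
    rw [neg_pow w, ← mul_assoc, ← pow_add, show j + 1 + j = 2 * j + 1 by ring, pow_succ, pow_mul]
    simp [neg_div]
  have key := Complex.norm_log_sub_logTaylor_le q hlt
  rw [hT, norm_neg, ← sub_eq_add_neg, sub_neg_eq_add] at key
  have hE : elementaryFactor w q =
      Complex.exp (Complex.log (1 - w) + ∑ j ∈ Finset.Icc 1 q, w ^ j / (j : ℂ)) := by
    rw [elementaryFactor, Complex.exp_add, Complex.exp_log hne]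
  rw [hE, Complex.norm_exp, Real.log_exp]
  refine (Complex.abs_re_le_norm _).trans (key.trans ?_)
  have h2 : (1 - ‖w‖)⁻¹ ≤ 2 := by
    rw [inv_le_comm₀ (by linarith) (by norm_num)]; linarith
  have h0 : 0 ≤ ‖w‖ ^ (q + 1) := by positivity
  calc ‖w‖ ^ (q + 1) * (1 - ‖w‖)⁻¹ / (q + 1) ≤ ‖w‖ ^ (q + 1) * (1 - ‖w‖)⁻¹ := by
        refine div_le_self (mul_nonneg h0 (inv_nonneg.2 (by linarith))) ?_
        have : (0 : ℝ) ≤ q := q.cast_nonneg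
        linarith
    _ ≤ ‖w‖ ^ (q + 1) * 2 := by gcongr
    _ = _ := mul_comm _ _

lemma abs_log_norm_elementaryFactor_le {w : ℂ} (hw : ‖w‖ ≤ 2) (q : ℕ) :
    |Real.log ‖elementaryFactor w q‖| ≤ |Real.log ‖1 - w‖| + q * 2 ^ q := by
  by_cases h : 1 - w = 0
  · simp only [elementaryFactor, h, zero_mul, norm_zero, Real.log_zero, abs_zero, zero_add]
    positivity
  rw [elementaryFactor, norm_mul, Real.log_mul (norm_ne_zero_iff.2 h)
    (norm_ne_zero_iff.2 (Complex.exp_ne_zero _)), Complex.norm_exp, Real.log_exp]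
  refine (abs_add_le _ _).trans (add_le_add_right ?_ _)
  refine (Complex.abs_re_le_norm _).trans ((norm_sum_le _ _).trans ?_)
  have : ∀ j ∈ Finset.Icc 1 q, ‖w ^ j / (j : ℂ)‖ ≤ 2 ^ q := by
    intro j hj
    rw [Finset.mem_Icc] at hj
    rw [norm_div, norm_pow, Complex.norm_natCast]
    calc ‖w‖ ^ j / j ≤ ‖w‖ ^ j := div_le_self (by positivity) (by exact_mod_cast hj.1)
      _ ≤ 2 ^ j := by gcongr
      _ ≤ 2 ^ q := pow_le_pow_right₀ (by norm_num) hj.2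
  simpa using Finset.sum_le_card_nsmul _ _ _ this

/-- The size of `log |E(w, q)|` relative to `|w| ^ (q + 1)`. -/
noncomputable def logFactorRatio (q : ℕ) (w : ℂ) : ℝ :=
  2 ^ (q + 1) * (1 + q * 2 ^ q) * (1 + if 1 / 2 < ‖w‖ then |Real.log ‖1 - w‖| else 0)

lemma abs_log_norm_elementaryFactor_le_mul {w : ℂ} (hw : ‖w‖ ≤ 2) (q : ℕ) :
    |Real.log ‖elementaryFactor w q‖| ≤ ‖w‖ ^ (q + 1) * logFactorRatio q w := by
  unfold logFactorRatio
  have hc : (0 : ℝ) ≤ q * 2 ^ q := by positivity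
  split_ifs with h
  · have h1 : 1 ≤ ‖w‖ ^ (q + 1) * 2 ^ (q + 1) := by
      rw [← mul_pow]; exact one_le_pow₀ (by linarith)
    have hl := abs_nonneg (Real.log ‖1 - w‖)
    calc _ ≤ |Real.log ‖1 - w‖| + q * 2 ^ q := abs_log_norm_elementaryFactor_le hw q
      _ ≤ 1 * ((1 + q * 2 ^ q) * (1 + |Real.log ‖1 - w‖|)) := by nlinarith
      _ ≤ (‖w‖ ^ (q + 1) * 2 ^ (q + 1)) * ((1 + q * 2 ^ q) * (1 + |Real.log ‖1 - w‖|)) := by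
        gcongr
      _ = _ := by ring
  · refine (abs_log_norm_elementaryFactor_le_of_norm_le_half (not_lt.1 h) q).trans ?_
    have h2 : (2 : ℝ) ≤ 2 ^ (q + 1) := by
      rw [pow_succ]; have : (1 : ℝ) ≤ 2 ^ q := one_le_pow₀ (by norm_num)
      linarith
    rw [mul_comm, add_zero, mul_one]
    gcongr
    nlinarith

/-- Trades every power of the logarithm for the one integrable singularity `u^(-1/2)`, through `|log
x| x^t < 1/t` with `t = 1/(2p)`. The bound 3 is the largest `|1 - w|` when `|w| ≤ 2`. -/
lemma abs_log_rpow_le {u p : ℝ} (hu : 0 ≤ u) (hu3 : u ≤ 3) (hp : 1 ≤ p) :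
    |Real.log u| ^ p ≤ (2 * p + 2) ^ p * (3 / u) ^ (1 / 2 : ℝ) := by
  rcases hu.eq_or_lt with rfl | hu
  · rw [Real.log_zero, abs_zero, Real.zero_rpow (by linarith)]; positivity
  set x := u / 3 with hx
  have hx0 : 0 < x := by positivity
  have hx1 : x ≤ 1 := by rw [hx]; linarith
  have ht : 0 < 1 / (2 * p) := by positivity
  have h := (Real.abs_log_mul_self_rpow_lt x (1 / (2 * p)) hx0 hx1 ht).le
  rw [abs_mul, abs_of_pos (Real.rpow_pos_of_pos hx0 _), one_div_one_div] at h
  set y := x⁻¹ ^ (1 / (2 * p)) with hy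
  have hxy : x ^ (1 / (2 * p)) * y = 1 := by
    rw [hy, Real.inv_rpow hx0.le, mul_inv_cancel₀ (Real.rpow_pos_of_pos hx0 _).ne']
  have hy1 : 1 ≤ y := Real.one_le_rpow (by rw [one_le_inv₀ hx0]; exact hx1) ht.le
  have h1 : |Real.log x| ≤ 2 * p * y := by
    calc |Real.log x| = |Real.log x| * x ^ (1 / (2 * p)) * y := by rw [mul_assoc, hxy, mul_one]
      _ ≤ _ := by gcongr
  have h3 : |Real.log 3| ≤ 2 := by
    rw [abs_of_nonneg (Real.log_nonneg (by norm_num))]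
    linarith [Real.log_le_sub_one_of_pos (show (0 : ℝ) < 3 by norm_num)]
  have h2 : |Real.log u| ≤ (2 * p + 2) * y := by
    have : u = x * 3 := by rw [hx]; ring
    rw [this, Real.log_mul hx0.ne' (by norm_num)]
    refine (abs_add_le _ _).trans ?_
    nlinarith
  calc |Real.log u| ^ p ≤ ((2 * p + 2) * y) ^ p := by gcongr
    _ = (2 * p + 2) ^ p * (3 / u) ^ (1 / 2 : ℝ) := by
      rw [Real.mul_rpow (by positivity) (by positivity), hy, ← Real.rpow_mul (by positivity)]
      congr 2
      · rw [hx, inv_div]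
      · field_simp

/-! ### Geometry of the disc in polar coordinates -/

/-- The point `r e^{iθ}`. -/
noncomputable def polarPoint (r θ : ℝ) : ℂ := (r : ℂ) * Complex.exp ((θ : ℂ) * Complex.I)

lemma norm_polarPoint {r : ℝ} (hr : 0 ≤ r) (θ : ℝ) : ‖polarPoint r θ‖ = r := by
  rw [polarPoint, norm_mul, Complex.norm_exp_ofReal_mul_I, mul_one, Complex.norm_real,
    Real.norm_of_nonneg hr]

lemma measurable_polarPoint (r : ℝ) : Measurable (polarPoint r) := by
  unfold polarPoint; fun_prop

lemma polarPoint_add_int_mul_two_pi (r θ : ℝ) (k : ℤ) :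
    polarPoint r (θ + k * (2 * Real.pi)) = polarPoint r θ := by
  unfold polarPoint
  congr 1
  push_cast
  rw [add_mul, show (k : ℂ) * (2 * Real.pi) * Complex.I = k * (2 * Real.pi * Complex.I) by ring]
  exact Complex.exp_periodic.int_mul k _

lemma exists_add_int_mul_two_pi_mem_Ioc (θ : ℝ) :
    ∃ k : ℤ, θ + k * (2 * Real.pi) ∈ Set.Ioc 0 (2 * Real.pi) := by
  obtain ⟨k, hk, -⟩ := existsUnique_add_zsmul_mem_Ioc Real.two_pi_pos θ 0
  exact ⟨k, by simpa using hk⟩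

lemma exists_eq_polarPoint (z : ℂ) :
    ∃ φ ∈ Set.Ioc 0 (2 * Real.pi), z = polarPoint ‖z‖ φ := by
  obtain ⟨k, hk⟩ := exists_add_int_mul_two_pi_mem_Ioc z.arg
  refine ⟨_, hk, ?_⟩
  rw [polarPoint_add_int_mul_two_pi, polarPoint, Complex.norm_mul_exp_arg_mul_I]

lemma conj_polarPoint_mul (x r φ θ : ℝ) :
    starRingEnd ℂ (polarPoint x φ) * polarPoint r θ = polarPoint (x * r) (θ - φ) := by
  unfold polarPoint
  rw [map_mul, Complex.conj_ofReal, ← Complex.exp_conj, map_mul, Complex.conj_I, Complex.conj_ofReal,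
    mul_mul_mul_comm, ← Complex.exp_add]
  push_cast
  congr 2; ring

lemma norm_one_sub_polarPoint_one (α : ℝ) : ‖1 - polarPoint 1 α‖ = 2 * |Real.sin (α / 2)| := by
  rw [norm_sub_rev, polarPoint, Complex.ofReal_one, one_mul, mul_comm,
    Complex.norm_exp_I_mul_ofReal_sub_one, norm_mul]
  simp

lemma polarPoint_eq_smul (x α : ℝ) : polarPoint x α = x * polarPoint 1 α := by
  simp [polarPoint]

lemma norm_one_sub_polarPoint_le {x : ℝ} (hx0 : 0 ≤ x) (hx1 : x ≤ 1) (α : ℝ) :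
    ‖1 - polarPoint x α‖ ≤ (1 - x) + |α| := by
  have h1 : 1 - polarPoint x α = ((1 - x : ℝ) : ℂ) + x * (1 - polarPoint 1 α) := by
    rw [polarPoint_eq_smul x]; push_cast; ring
  rw [h1]
  refine (norm_add_le _ _).trans ?_
  rw [norm_mul, Complex.norm_real, Complex.norm_real, Real.norm_of_nonneg hx0,
    Real.norm_of_nonneg (sub_nonneg.2 hx1), norm_one_sub_polarPoint_one]
  have h2 : |Real.sin (α / 2)| ≤ |α / 2| := Real.abs_sin_le_abs
  rw [abs_div, abs_two] at h2
  have h3 : 0 ≤ |α| := abs_nonneg _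
  have h4 : 0 ≤ |Real.sin (α / 2)| := abs_nonneg _
  nlinarith

lemma one_sub_le_norm_one_sub_polarPoint {x : ℝ} (hx0 : 0 ≤ x) (α : ℝ) :
    1 - x ≤ ‖1 - polarPoint x α‖ := by
  have := norm_sub_norm_le (1 : ℂ) (polarPoint x α)
  rwa [norm_one, norm_polarPoint hx0] at this

/-- Moving radially to the circle costs `1 - x`, itself at most the distance, so the chord is at
most twice the distance; Jordan's inequality then gives exactly the aperture `π` of the Carleson
squares. -/
lemma abs_le_pi_mul_norm_one_sub_polarPoint {x : ℝ} (hx0 : 0 ≤ x) (hx1 : x ≤ 1) {α : ℝ}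
    (hα : |α| ≤ Real.pi) : |α| ≤ Real.pi * ‖1 - polarPoint x α‖ := by
  have h1 : 1 - polarPoint 1 α = (1 - polarPoint x α) - ((1 - x : ℝ) : ℂ) * polarPoint 1 α := by
    rw [polarPoint_eq_smul x]; push_cast; ring
  have h2 := norm_sub_le (1 - polarPoint x α) (((1 - x : ℝ) : ℂ) * polarPoint 1 α)
  rw [← h1, norm_mul, norm_polarPoint zero_le_one, mul_one, Complex.norm_real,
    Real.norm_of_nonneg (sub_nonneg.2 hx1), norm_one_sub_polarPoint_one] at h2
  have h3 := one_sub_le_norm_one_sub_polarPoint hx0 α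
  have h4 : 2 / Real.pi * |α / 2| ≤ |Real.sin (α / 2)| := by
    refine Real.mul_abs_le_abs_sin ?_
    rw [abs_div, abs_two]; linarith
  rw [abs_div, abs_two, div_mul_div_comm, mul_comm Real.pi, mul_div_mul_left _ _ two_ne_zero,
    div_le_iff₀ Real.pi_pos] at h4
  nlinarith [Real.pi_pos]

lemma polarPoint_im (x α : ℝ) : (polarPoint x α).im = x * Real.sin α := by
  rw [polarPoint, Complex.im_ofReal_mul, Complex.exp_ofReal_mul_I_im]

lemma mul_abs_sin_le_norm_one_sub_polarPoint {x : ℝ} (hx0 : 0 ≤ x) (α : ℝ) :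
    x * |Real.sin α| ≤ ‖1 - polarPoint x α‖ := by
  have := Complex.abs_im_le_norm (1 - polarPoint x α)
  rwa [Complex.sub_im, Complex.one_im, zero_sub, abs_neg, polarPoint_im, abs_mul,
    abs_of_nonneg hx0] at this

lemma mul_abs_sin_le_norm_polarPoint_sub {x : ℝ} (hx0 : 0 ≤ x) (r φ θ : ℝ) :
    x * |Real.sin (θ - φ)| ≤ ‖polarPoint x φ - polarPoint r θ‖ := by
  have h : ‖polarPoint x φ - polarPoint r θ‖ = ‖polarPoint x (φ - θ) - r‖ := by
    rw [← mul_one ‖polarPoint x (φ - θ) - r‖, ← norm_polarPoint zero_le_one θ, ← norm_mul, sub_mul]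
    congr 2
    · unfold polarPoint
      rw [mul_assoc, Complex.ofReal_one, one_mul, ← Complex.exp_add]
      push_cast; congr 2; ring
    · exact polarPoint_eq_smul _ _
  have := Complex.abs_im_le_norm (polarPoint x (φ - θ) - r)
  rw [Complex.sub_im, Complex.ofReal_im, sub_zero, polarPoint_im, abs_mul, abs_of_nonneg hx0,
    ← neg_sub θ φ, Real.sin_neg, abs_neg] at this
  rwa [h, ← neg_sub θ φ]

/-! ### The argument of the factor and its relation to Carleson squares -/

/-- The argument `(1 - |z|²) / (1 - z̄ ζ)` of the elementary factor attached to the zero `z`. -/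
noncomputable def tsujiRatio (z ζ : ℂ) : ℂ :=
  (1 - (‖z‖ : ℂ) ^ 2) / (1 - starRingEnd ℂ z * ζ)

lemma norm_tsujiRatio {z : ℂ} (hz : ‖z‖ < 1) (ζ : ℂ) :
    ‖tsujiRatio z ζ‖ = (1 - ‖z‖ ^ 2) / ‖1 - starRingEnd ℂ z * ζ‖ := by
  rw [tsujiRatio, norm_div]
  congr 1
  have : (1 - (‖z‖ : ℂ) ^ 2) = ((1 - ‖z‖ ^ 2 : ℝ) : ℂ) := by push_cast; ring
  rw [this, Complex.norm_real, Real.norm_of_nonneg]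
  nlinarith [norm_nonneg z]

lemma one_sub_le_norm_one_sub_conj_mul {z ζ : ℂ} (hζ : ‖ζ‖ < 1) :
    1 - ‖z‖ ≤ ‖1 - starRingEnd ℂ z * ζ‖ := by
  have := norm_sub_norm_le (1 : ℂ) (starRingEnd ℂ z * ζ)
  rw [norm_one, norm_mul, Complex.norm_conj] at this
  nlinarith [norm_nonneg z]

lemma one_sub_le_norm_one_sub_conj_mul' {z ζ : ℂ} (hz : ‖z‖ < 1) :
    1 - ‖ζ‖ ≤ ‖1 - starRingEnd ℂ z * ζ‖ := by
  have := norm_sub_norm_le (1 : ℂ) (starRingEnd ℂ z * ζ)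
  rw [norm_one, norm_mul, Complex.norm_conj] at this
  nlinarith [norm_nonneg ζ]

lemma norm_tsujiRatio_le {z ζ : ℂ} (hz : ‖z‖ < 1) (hζ : ‖ζ‖ < 1) : ‖tsujiRatio z ζ‖ ≤ 2 := by
  have h := one_sub_le_norm_one_sub_conj_mul (z := z) hζ
  rw [norm_tsujiRatio hz, div_le_iff₀ (by linarith)]
  nlinarith [norm_nonneg z]

lemma norm_one_sub_tsujiRatio {z ζ : ℂ} (hz : ‖z‖ < 1) (hζ : ‖ζ‖ < 1) :
    ‖1 - tsujiRatio z ζ‖ = ‖z‖ * ‖z - ζ‖ / ‖1 - starRingEnd ℂ z * ζ‖ := by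
  have h := one_sub_le_norm_one_sub_conj_mul (z := z) hζ
  have hne : 1 - starRingEnd ℂ z * ζ ≠ 0 := norm_pos_iff.1 (by linarith)
  have : 1 - tsujiRatio z ζ = starRingEnd ℂ z * (z - ζ) / (1 - starRingEnd ℂ z * ζ) := by
    rw [tsujiRatio, eq_div_iff hne, sub_mul, div_mul_cancel₀ _ hne, ← Complex.conj_mul']
    ring
  rw [this, norm_div, norm_mul, Complex.norm_conj]

lemma mem_carlesonSquare_of_norm_lt {z : ℂ} (hz : ‖z‖ < 1) {r θ t : ℝ} (hr0 : 0 < r) (hr1 : r < 1)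
    (h : ‖1 - starRingEnd ℂ z * polarPoint r θ‖ < t) : z ∈ carlesonSquare θ t := by
  have hd := one_sub_le_norm_one_sub_conj_mul (z := z) (ζ := polarPoint r θ)
    (by rwa [norm_polarPoint hr0.le])
  obtain ⟨φ, -, hφ⟩ := exists_eq_polarPoint z
  obtain ⟨k, hk, -⟩ := existsUnique_add_zsmul_mem_Ioc Real.two_pi_pos φ (θ - Real.pi)
  simp only [zsmul_eq_mul] at hk
  rw [← polarPoint_add_int_mul_two_pi _ _ k] at hφ
  set ψ := φ + k * (2 * Real.pi)
  have hα : |θ - ψ| ≤ Real.pi := by rw [abs_le]; constructor <;> linarith [hk.1, hk.2]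
  have h1 := abs_le_pi_mul_norm_one_sub_polarPoint (x := ‖z‖ * r) (by positivity)
    (by nlinarith [norm_nonneg z]) hα
  rw [← conj_polarPoint_mul, ← hφ] at h1
  have h2 : |θ - ψ| < Real.pi * t := h1.trans_lt (by gcongr)
  rw [abs_lt] at h2
  exact ⟨‖z‖, ψ, by linarith, hz.le, by linarith, by linarith, hφ⟩

/-! ### Dyadic bound for the sum of the weights -/

/-- Thresholds start at `1/2`, so each is an admissible `δ < 1`. The scale used lies one step above
the dyadic interval of `x`, which makes the inequality strict and costs the factor 4. -/
lemma inv_pow_le_dyadic_sum {x y : ℝ} {N : ℕ} (hy : (1 / 2 : ℝ) ^ (N + 1) < y) (hxy : y ≤ x) (m : ℕ) :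
    x⁻¹ ^ m ≤ 4 ^ m + ∑ k ∈ Finset.range N,
      if x < (1 / 2 : ℝ) ^ (k + 1) then (4 / (1 / 2 : ℝ) ^ (k + 1)) ^ m else 0 := by
  have hx0 : 0 < x := lt_of_lt_of_le (lt_trans (by positivity) hy) hxy
  have hnn : ∀ k ∈ Finset.range N, (0 : ℝ) ≤
      if x < (1 / 2 : ℝ) ^ (k + 1) then (4 / (1 / 2 : ℝ) ^ (k + 1)) ^ m else 0 := by
    intro k _
    split_ifs <;> positivity
  by_cases h4 : 1 / 4 ≤ x
  · have : x⁻¹ ≤ 4 := by rw [inv_le_comm₀ hx0 (by norm_num)]; linarith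
    have h2 : x⁻¹ ^ m ≤ 4 ^ m := by gcongr
    linarith [Finset.sum_nonneg hnn]
  · push Not at h4
    obtain ⟨j, hj1, hj2⟩ := exists_nat_pow_near_of_lt_one hx0 (by linarith)
      (show (0 : ℝ) < 1 / 2 by norm_num) (by norm_num)
    have hj : 2 < j + 1 := by
      have : (1 / 2 : ℝ) ^ (j + 1) < (1 / 2) ^ 2 := by norm_num at h4 hj1 ⊢; linarith
      exact (pow_lt_pow_iff_right_of_lt_one₀ (by norm_num) (by norm_num)).1 this
    obtain ⟨k, rfl⟩ : ∃ k, j = k + 2 := ⟨j - 2, by omega⟩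
    have hkN : k < N := by
      have : (1 / 2 : ℝ) ^ (N + 1) < (1 / 2) ^ (k + 2) := by linarith
      have := (pow_lt_pow_iff_right_of_lt_one₀ (by norm_num) (by norm_num)).1 this
      omega
    have hlt : x < (1 / 2 : ℝ) ^ (k + 1) := by
      refine hj2.trans_lt ?_
      exact pow_lt_pow_right_of_lt_one₀ (by norm_num) (by norm_num) (by omega)
    have hterm := Finset.single_le_sum hnn (Finset.mem_range.2 hkN)
    rw [if_pos hlt] at hterm
    have : x⁻¹ ≤ 4 / (1 / 2 : ℝ) ^ (k + 1) := by
      rw [inv_le_comm₀ hx0 (by positivity), inv_div]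
      refine le_trans (le_of_eq ?_) hj1.le
      ring
    have h2 : x⁻¹ ^ m ≤ (4 / (1 / 2 : ℝ) ^ (k + 1)) ^ m := by gcongr
    have h0 : (0 : ℝ) ≤ 4 ^ m := by positivity
    linarith

lemma natCast_le_two_mul_log {y : ℝ} (hy : 0 < y) {N : ℕ} (h : y ≤ (1 / 2 : ℝ) ^ N) :
    (N : ℝ) ≤ 2 * Real.log (1 / y) := by
  have h1 := Real.log_le_log hy h
  rw [Real.log_pow, one_div, Real.log_inv] at h1
  rw [one_div, Real.log_inv]
  have h2 := Real.log_two_gt_d9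
  have h3 : (0 : ℝ) ≤ N := N.cast_nonneg
  nlinarith

/-- Scale `t` contributes about `t^(-s-1) t^γ`. Bounding each scale by the worst one, `t = 1 - r`,
covers `γ = s + 1` too; the number of scales is the logarithm. -/
lemma exists_tsum_norm_tsujiRatio_pow_le {ι : Type*} {z : ι → ℂ} (hz : ∀ n, ‖z n‖ < 1) {s : ℕ}
    (hsum : Summable fun n => (1 - ‖z n‖) ^ (s + 1)) {γ : ℝ} (hγ1 : γ ≤ (s : ℝ) + 1)
    (hC : CarlesonCondition z s γ) :
    ∃ C : ℝ, 0 < C ∧ ∀ r θ : ℝ, 0 < r → r < 1 →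
      ∑' n, ENNReal.ofReal (‖tsujiRatio (z n) (polarPoint r θ)‖ ^ (s + 1)) ≤
        ENNReal.ofReal (C * ((1 - r) ^ (γ - s - 1) * (Real.log (1 / (1 - r)) + 1))) := by
  obtain ⟨C₁, hC₁⟩ := hC
  set T := ∑' n, (1 - ‖z n‖) ^ (s + 1)
  have hd : ∀ n, 0 ≤ (1 - ‖z n‖) ^ (s + 1) := fun n => pow_nonneg (sub_nonneg.2 (hz n).le) _
  have hT : 0 ≤ T := tsum_nonneg hd
  refine ⟨8 ^ (s + 1) * (T + 2 * |C₁| + 1), by positivity, fun r θ hr0 hr1 => ?_⟩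
  have hy0 : 0 < 1 - r := by linarith
  have hy1 : 1 - r ≤ 1 := by linarith
  obtain ⟨N, hN1, hN2⟩ := exists_nat_pow_near_of_lt_one hy0 hy1
      (show (0 : ℝ) < 1 / 2 by norm_num) (by norm_num)
  set L := Real.log (1 / (1 - r)) with hL
  have hL0 : 0 ≤ L := Real.log_nonneg (by rw [le_div_iff₀ hy0]; linarith)
  have hNL : (N : ℝ) ≤ 2 * L := natCast_le_two_mul_log hy0 hN2
  set Y := (1 - r) ^ (γ - s - 1) with hY
  have hY1 : 1 ≤ Y := Real.one_le_rpow_of_pos_of_le_one_of_nonpos hy0 hy1 (by linarith)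
  set x : ι → ℝ := fun n => ‖1 - starRingEnd ℂ (z n) * polarPoint r θ‖ with hx
  have hxy : ∀ n, 1 - r ≤ x n := fun n => by
    have := one_sub_le_norm_one_sub_conj_mul' (ζ := polarPoint r θ) (hz n)
    rwa [norm_polarPoint hr0.le] at this
  have hscale : ∀ (u : Finset ι) (t : ℝ), 0 < t → t < 1 →
      ∑ n ∈ u, (if x n < t then (1 - ‖z n‖) ^ (s + 1) else 0) ≤ |C₁| * t ^ γ := by
    intro u t ht0 ht1
    classical
    have h1 := hC₁ θ t ht0 ht1
    have h2 : ∑' n : {n : ι // z n ∈ carlesonSquare θ t}, (1 - ‖z n‖) ^ (s + 1) =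
        ∑' n, {n | z n ∈ carlesonSquare θ t}.indicator (fun n => (1 - ‖z n‖) ^ (s + 1)) n :=
      tsum_subtype {n | z n ∈ carlesonSquare θ t} (fun n => (1 - ‖z n‖) ^ (s + 1))
    rw [h2] at h1
    calc _ ≤ ∑ n ∈ u, {n | z n ∈ carlesonSquare θ t}.indicator
              (fun n => (1 - ‖z n‖) ^ (s + 1)) n := by
          refine Finset.sum_le_sum fun n _ => ?_
          split_ifs with h
          · rw [Set.indicator_of_mem]
            exact mem_carlesonSquare_of_norm_lt (hz n) hr0 hr1 h
          · exact Set.indicator_nonneg (fun n _ => hd n) n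
      _ ≤ _ := (hsum.indicator _).sum_le_tsum _ fun n _ => Set.indicator_nonneg (fun n _ => hd n) n
      _ ≤ C₁ * t ^ γ := h1
      _ ≤ _ := by gcongr; exact le_abs_self _
  rw [ENNReal.tsum_eq_iSup_sum]
  refine iSup_le fun u => ?_
  rw [← ENNReal.ofReal_sum_of_nonneg (fun _ _ => by positivity)]
  refine ENNReal.ofReal_le_ofReal ?_
  calc ∑ n ∈ u, ‖tsujiRatio (z n) (polarPoint r θ)‖ ^ (s + 1)
      ≤ ∑ n ∈ u, 2 ^ (s + 1) * ((1 - ‖z n‖) ^ (s + 1) * (4 ^ (s + 1) + ∑ k ∈ Finset.range N,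
          if x n < (1 / 2 : ℝ) ^ (k + 1) then (4 / (1 / 2 : ℝ) ^ (k + 1)) ^ (s + 1) else 0)) := by
        refine Finset.sum_le_sum fun n _ => ?_
        have h1 := inv_pow_le_dyadic_sum hN1 (hxy n) (s + 1)
        have h2 := mul_le_mul_of_nonneg_left h1 (hd n)
        refine le_trans ?_ (mul_le_mul_of_nonneg_left h2 (by positivity))
        rw [norm_tsujiRatio (hz n), ← mul_pow, ← mul_pow]
        have h3 := (hz n).le
        have h4 := norm_nonneg (z n)
        refine pow_le_pow_left₀ (div_nonneg (by nlinarith) (norm_nonneg _)) ?_ _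
        rw [div_eq_mul_inv, ← mul_assoc]
        gcongr
        nlinarith
    _ = 2 ^ (s + 1) * (4 ^ (s + 1) * ∑ n ∈ u, (1 - ‖z n‖) ^ (s + 1) + ∑ k ∈ Finset.range N,
          (4 / (1 / 2 : ℝ) ^ (k + 1)) ^ (s + 1) *
            ∑ n ∈ u, if x n < (1 / 2 : ℝ) ^ (k + 1) then (1 - ‖z n‖) ^ (s + 1) else 0) := by
        rw [← Finset.mul_sum]
        simp only [mul_add, Finset.mul_sum, Finset.sum_add_distrib]
        congr 1
        · refine Finset.sum_congr rfl fun n _ => by ring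
        · rw [Finset.sum_comm]
          refine Finset.sum_congr rfl fun k _ => Finset.sum_congr rfl fun n _ => ?_
          split_ifs <;> ring
    _ ≤ 2 ^ (s + 1) * (4 ^ (s + 1) * T + ∑ k ∈ Finset.range N, 4 ^ (s + 1) * |C₁| * Y) := by
        refine mul_le_mul_of_nonneg_left (add_le_add (mul_le_mul_of_nonneg_left ?_ (by positivity))
          (Finset.sum_le_sum fun k hk => ?_)) (by positivity)
        · exact hsum.sum_le_tsum _ fun n _ => hd n
        · rw [Finset.mem_range] at hk
          set t := (1 / 2 : ℝ) ^ (k + 1)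
          have ht0 : 0 < t := by positivity
          have ht1 : t < 1 := pow_lt_one₀ (by norm_num) (by norm_num) (by omega)
          refine (mul_le_mul_of_nonneg_left (hscale u t ht0 ht1) (by positivity)).trans ?_
          have h1 : (1 - r) ≤ t := hN2.trans
            (pow_le_pow_of_le_one (by norm_num) (by norm_num) (by omega))
          have h2 : t ^ (γ - s - 1) ≤ Y := Real.rpow_le_rpow_of_nonpos hy0 h1 (by linarith)
          have h3 : t ^ γ = t ^ (s + 1) * t ^ (γ - s - 1) := by
            rw [← Real.rpow_natCast t, ← Real.rpow_add ht0]; push_cast; congr 1; ring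
          calc (4 / t) ^ (s + 1) * (|C₁| * t ^ γ) = 4 ^ (s + 1) * |C₁| * t ^ (γ - s - 1) := by
                rw [h3, div_pow]; field_simp
            _ ≤ _ := by gcongr
    _ = 8 ^ (s + 1) * (T + N * |C₁| * Y) := by
        rw [Finset.sum_const, Finset.card_range, nsmul_eq_mul,
          show (8 : ℝ) = 2 * 4 by norm_num, mul_pow]
        ring
    _ ≤ 8 ^ (s + 1) * (T + 2 * L * |C₁| * Y) := by gcongr
    _ ≤ 8 ^ (s + 1) * (T + 2 * |C₁| + 1) * (Y * (L + 1)) := by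
        rw [mul_assoc (8 ^ (s + 1))]
        gcongr
        have e1 : T * 1 ≤ T * (Y * (L + 1)) := by
          gcongr; nlinarith
        have e2 : 0 ≤ |C₁| * Y := by positivity
        have e3 : 0 ≤ Y * (L + 1) := by positivity
        nlinarith

/-! ### Weighted Hölder inequality and its integrated form -/

lemma tsum_mul_rpow_le {ι : Type*} {p : ℝ} (hp : 1 ≤ p) (a h : ι → ℝ≥0∞) :
    (∑' n, a n * h n) ^ p ≤ (∑' n, a n) ^ (p - 1) * ∑' n, a n * h n ^ p := by
  have hp0 : 0 < p := by linarith
  have key : ∑' n, a n * h n ≤ (∑' n, a n) ^ (1 - p⁻¹) * (∑' n, a n * h n ^ p) ^ p⁻¹ := by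
    rw [ENNReal.tsum_eq_iSup_sum]
    refine iSup_le fun u => (ENNReal.inner_le_weight_mul_Lp_of_nonneg u hp a h).trans ?_
    have : 0 ≤ 1 - p⁻¹ := sub_nonneg.2 (inv_le_one_of_one_le₀ hp)
    gcongr <;> exact ENNReal.sum_le_tsum u
  refine (ENNReal.rpow_le_rpow key hp0.le).trans (le_of_eq ?_)
  rw [ENNReal.mul_rpow_of_nonneg _ _ hp0.le, ← ENNReal.rpow_mul, ← ENNReal.rpow_mul,
    inv_mul_cancel₀ hp0.ne', ENNReal.rpow_one, sub_mul, inv_mul_cancel₀ hp0.ne', one_mul]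

lemma lintegral_tsum_mul_rpow_le {α ι : Type*} [MeasurableSpace α] [Countable ι] {μ : Measure α}
    {a h : ι → α → ℝ≥0∞} (ha : ∀ n, Measurable (a n)) (hh : ∀ n, Measurable (h n)) {p : ℝ}
    (hp : 1 ≤ p) {M C : ℝ≥0∞} (hM : ∀ x, ∑' n, a n x ≤ M)
    (hC : ∀ n, ∫⁻ x, a n x * h n x ^ p ∂μ ≤ C * ∫⁻ x, a n x ∂μ) :
    ∫⁻ x, (∑' n, a n x * h n x) ^ p ∂μ ≤ C * M ^ p * μ Set.univ := by
  have hp1 : 0 ≤ p - 1 := by linarith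
  have hm : ∀ n, Measurable fun x => a n x * h n x ^ p := fun n =>
    (ha n).mul ((hh n).pow_const p)
  calc ∫⁻ x, (∑' n, a n x * h n x) ^ p ∂μ
      ≤ ∫⁻ x, M ^ (p - 1) * ∑' n, a n x * h n x ^ p ∂μ := by
        refine lintegral_mono fun x => (tsum_mul_rpow_le hp _ _).trans ?_
        gcongr
        exact hM x
    _ = M ^ (p - 1) * ∑' n, ∫⁻ x, a n x * h n x ^ p ∂μ := by
        rw [lintegral_const_mul _ (Measurable.tsum hm),
          lintegral_tsum fun n => (hm n).aemeasurable]
    _ ≤ M ^ (p - 1) * (C * ∑' n, ∫⁻ x, a n x ∂μ) := by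
        refine mul_le_mul' le_rfl ?_
        rw [← ENNReal.tsum_mul_left]
        exact ENNReal.tsum_le_tsum hC
    _ ≤ M ^ (p - 1) * (C * (M * μ Set.univ)) := by
        rw [← lintegral_tsum fun n => (ha n).aemeasurable]
        gcongr
        refine (lintegral_mono hM).trans ?_
        rw [lintegral_const]
    _ = C * (M ^ (p - 1) * M ^ (1 : ℝ)) * μ Set.univ := by rw [ENNReal.rpow_one]; ring
    _ = _ := by rw [← ENNReal.rpow_add_of_nonneg _ _ hp1 zero_le_one, sub_add_cancel]

/-! ### The logarithmic singularity of one factor -/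

lemma lintegral_Ioc_rpow_neg_half {T : ℝ} (hT : 0 ≤ T) :
    ∫⁻ y in Set.Ioc 0 T, ENNReal.ofReal (y ^ (-(1 / 2) : ℝ)) =
      ENNReal.ofReal (2 * T ^ (1 / 2 : ℝ)) := by
  have hint := (intervalIntegral.intervalIntegrable_rpow' (a := 0) (b := T)
    (show (-1 : ℝ) < -(1 / 2) by norm_num)).1
  rw [← ofReal_integral_eq_lintegral_ofReal hint, ← intervalIntegral.integral_of_le hT,
    integral_rpow (Or.inl (by norm_num))]
  · congr 1
    rw [show (-(1 / 2) + 1 : ℝ) = 1 / 2 by norm_num, Real.zero_rpow (by norm_num)]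
    ring
  · filter_upwards [ae_restrict_mem measurableSet_Ioc] with y hy
    exact Real.rpow_nonneg hy.1.le _

/-- Around the nearest zero `φ + kπ` of the sine, `|sin| ≥ |y|/2`, so the integrand is dominated by
`G |y|`. Five values of `k`, two sides and `8 √t` for each side give 80. -/
lemma lintegral_truncated_abs_sin_rpow_le {φ : ℝ} (hφ : φ ∈ Set.Ioc 0 (2 * Real.pi)) {t : ℝ}
    (ht : 0 ≤ t) :
    ∫⁻ θ in Set.Ioc 0 (2 * Real.pi), ENNReal.ofReal
        (if |Real.sin (θ - φ)| ≤ t then |Real.sin (θ - φ)| ^ (-(1 / 2) : ℝ) else 0) ≤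
      ENNReal.ofReal (80 * t ^ (1 / 2 : ℝ)) := by
  set G : ℝ → ℝ≥0∞ := (Set.Ioc 0 (2 * t)).indicator
    fun y => ENNReal.ofReal (2 * y ^ (-(1 / 2) : ℝ)) with hG
  have hGm : Measurable G := by
    refine Measurable.indicator ?_ measurableSet_Ioc
    fun_prop
  have hGint : ∫⁻ y, G y ≤ ENNReal.ofReal (8 * t ^ (1 / 2 : ℝ)) := by
    rw [hG, lintegral_indicator measurableSet_Ioc]
    simp_rw [ENNReal.ofReal_mul (show (0 : ℝ) ≤ 2 by norm_num)]
    rw [lintegral_const_mul _ (by fun_prop), lintegral_Ioc_rpow_neg_half (by positivity),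
      ← ENNReal.ofReal_mul (by norm_num)]
    refine ENNReal.ofReal_le_ofReal ?_
    rw [Real.mul_rpow (by norm_num) ht]
    have h2 : (2 : ℝ) ^ (1 / 2 : ℝ) ≤ 2 := by
      conv_rhs => rw [← Real.rpow_one 2]
      exact Real.rpow_le_rpow_of_exponent_le (by norm_num) (by norm_num)
    have := Real.rpow_nonneg ht (1 / 2)
    nlinarith
  have hpt : ∀ θ ∈ Set.Ioc 0 (2 * Real.pi), ENNReal.ofReal
      (if |Real.sin (θ - φ)| ≤ t then |Real.sin (θ - φ)| ^ (-(1 / 2) : ℝ) else 0) ≤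
      ∑ k ∈ Finset.Icc (-2 : ℤ) 2, (G (θ - (φ + k * Real.pi)) + G (-(θ - (φ + k * Real.pi)))) := by
    intro θ hθ
    split_ifs with hsin
    swap
    · simp
    by_cases h0 : Real.sin (θ - φ) = 0
    · rw [h0, abs_zero, Real.zero_rpow (by norm_num), ENNReal.ofReal_zero]
      exact zero_le
    have hπ := Real.pi_pos
    set k := round ((θ - φ) / Real.pi) with hk
    have hround := abs_sub_round ((θ - φ) / Real.pi)
    rw [← hk] at hround
    set y := θ - (φ + k * Real.pi) with hy
    have hyk : y = ((θ - φ) / Real.pi - k) * Real.pi := by rw [hy]; field_simp; ring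
    have hy2 : |y| ≤ Real.pi / 2 := by
      rw [hyk, abs_mul, abs_of_pos hπ]; nlinarith
    have hkmem : k ∈ Finset.Icc (-2 : ℤ) 2 := by
      have h1 : (θ - φ) / Real.pi < 2 := by rw [div_lt_iff₀ hπ]; linarith [hθ.2, hφ.1]
      have h2 : -2 < (θ - φ) / Real.pi := by rw [lt_div_iff₀ hπ]; linarith [hθ.1, hφ.2]
      rw [abs_le] at hround
      have h3 : (k : ℝ) < 3 := by linarith
      have h4 : (-3 : ℝ) < k := by linarith
      have h3' : k < 3 := by exact_mod_cast h3
      have h4' : -3 < k := by exact_mod_cast h4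
      rw [Finset.mem_Icc]; omega
    refine le_trans ?_ (Finset.single_le_sum (f := fun k : ℤ => G (θ - (φ + k * Real.pi)) +
      G (-(θ - (φ + k * Real.pi)))) (fun _ _ => zero_le) hkmem)
    have hsy : |Real.sin (θ - φ)| = |Real.sin y| := by
      rw [show y = θ - φ - k * Real.pi by rw [hy]; ring, Real.sin_sub_int_mul_pi, abs_mul,
        abs_neg_one_zpow, one_mul]
    have hlow : |y| / 2 ≤ |Real.sin (θ - φ)| := by
      rw [hsy]
      refine le_trans ?_ (Real.mul_abs_le_abs_sin hy2)
      have : 1 / 2 ≤ 2 / Real.pi := by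
        rw [div_le_div_iff₀ two_pos hπ]; linarith [Real.pi_le_four]
      nlinarith [abs_nonneg y]
    have hy0 : 0 < |y| := by
      rw [abs_pos]; rintro h
      rw [h, Real.sin_zero, abs_zero, abs_eq_zero] at hsy
      exact h0 hsy
    have hGy : ENNReal.ofReal (|Real.sin (θ - φ)| ^ (-(1 / 2) : ℝ)) ≤ G |y| := by
      rw [hG, Set.indicator_of_mem (show |y| ∈ Set.Ioc 0 (2 * t) from ⟨hy0, by linarith⟩)]
      refine ENNReal.ofReal_le_ofReal ?_
      refine (Real.rpow_le_rpow_of_nonpos (by positivity) hlow (by norm_num)).trans ?_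
      rw [Real.div_rpow hy0.le (by norm_num), div_eq_mul_inv, ← Real.rpow_neg (by norm_num),
        neg_neg, mul_comm]
      gcongr
      conv_rhs => rw [← Real.rpow_one 2]
      exact Real.rpow_le_rpow_of_exponent_le (by norm_num) (by norm_num)
    refine hGy.trans ?_
    rcases abs_cases y with ⟨h, -⟩ | ⟨h, -⟩ <;> rw [h]
    · exact le_self_add
    · exact le_add_self
  refine (setLIntegral_mono' measurableSet_Ioc hpt).trans ?_
  refine (setLIntegral_le_lintegral _ _).trans ?_
  rw [lintegral_finsetSum _ fun k _ => by fun_prop]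
  have hone : ∀ k : ℤ, ∫⁻ θ, (G (θ - (φ + k * Real.pi)) + G (-(θ - (φ + k * Real.pi)))) ≤
      ENNReal.ofReal (16 * t ^ (1 / 2 : ℝ)) := by
    intro k
    rw [lintegral_add_left (by fun_prop), lintegral_sub_right_eq_self G,
      lintegral_sub_right_eq_self (fun y => G (-y)), lintegral_neg_eq_self]
    refine (add_le_add hGint hGint).trans (le_of_eq ?_)
    rw [← ENNReal.ofReal_add (by positivity) (by positivity)]
    congr 1; ring
  refine (Finset.sum_le_sum fun k _ => hone k).trans (le_of_eq ?_)
  rw [Finset.sum_const, ← ENNReal.ofReal_nsmul]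
  congr 1
  simp
  ring

lemma ae_sin_sub_ne_zero (φ : ℝ) : ∀ᵐ θ : ℝ, Real.sin (θ - φ) ≠ 0 := by
  have hc : (Set.range fun k : ℤ => φ + k * Real.pi).Countable := Set.countable_range _
  filter_upwards [hc.ae_notMem volume] with θ hθ h
  obtain ⟨k, hk⟩ := Real.sin_eq_zero_iff.1 h
  exact hθ ⟨k, by simp only; linarith⟩

lemma one_sub_le_four_mul_of_half_lt_norm_tsujiRatio {z ζ : ℂ} (hz : ‖z‖ < 1) (hζ : ‖ζ‖ < 1)
    (h : 1 / 2 < ‖tsujiRatio z ζ‖) : ‖1 - starRingEnd ℂ z * ζ‖ < 4 * (1 - ‖z‖) := by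
  have h0 := one_sub_le_norm_one_sub_conj_mul (z := z) hζ
  rw [norm_tsujiRatio hz, lt_div_iff₀ (by linarith)] at h
  nlinarith [norm_nonneg z]

/-- A large ratio forces `|1 - z̄ζ| < 4(1 - x)`. This confines the angle, and in `|1 - w| = |z||z -
ζ|/|1 - z̄ζ|` it bounds the denominator while `|z - ζ| ≥ x |sin|` bounds the numerator. -/
lemma abs_log_rpow_le_of_half_lt_norm_tsujiRatio {ρ₀ x r φ θ p : ℝ} (hρ : 0 < ρ₀) (hx0 : ρ₀ ≤ x)
    (hx1 : x < 1) (hr0 : 0 < r) (hr1 : r < 1) (hp : 1 ≤ p) (hsin : Real.sin (θ - φ) ≠ 0)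
    (h : 1 / 2 < ‖tsujiRatio (polarPoint x φ) (polarPoint r θ)‖) :
    |Real.sin (θ - φ)| ≤ 8 / ρ₀ * (1 - x) ∧
    |Real.log ‖1 - tsujiRatio (polarPoint x φ) (polarPoint r θ)‖| ^ p ≤
      (2 * p + 2) ^ p * (12 / ρ₀ ^ 2) ^ (1 / 2 : ℝ) * (1 - x) ^ (1 / 2 : ℝ) *
        |Real.sin (θ - φ)| ^ (-(1 / 2) : ℝ) := by
  have hx : 0 < x := by linarith
  have hz : ‖polarPoint x φ‖ < 1 := by rwa [norm_polarPoint hx.le]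
  have hζ : ‖polarPoint r θ‖ < 1 := by rwa [norm_polarPoint hr0.le]
  have h4 := one_sub_le_four_mul_of_half_lt_norm_tsujiRatio hz hζ h
  have hle := one_sub_le_norm_one_sub_conj_mul' (ζ := polarPoint r θ) hz
  have hpos := one_sub_le_norm_one_sub_conj_mul (z := polarPoint x φ) hζ
  have hnorm := norm_one_sub_tsujiRatio hz hζ
  have hnum := mul_abs_sin_le_norm_polarPoint_sub hx.le r φ θ
  have hden := mul_abs_sin_le_norm_one_sub_polarPoint (x := x * r) (by positivity) (θ - φ)
  rw [← conj_polarPoint_mul] at hden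
  have htwo := norm_tsujiRatio_le hz hζ
  rw [norm_polarPoint hx.le] at h4 hpos hnorm
  rw [norm_polarPoint hr0.le] at hle
  set S := |Real.sin (θ - φ)| with hS
  have hS0 : 0 < S := abs_pos.2 hsin
  have hS1 : S ≤ 1 := Real.abs_sin_le_one _
  have hd : 0 < 1 - x := by linarith
  constructor
  · rw [div_mul_eq_mul_div, le_div_iff₀ hρ]
    -- For small `r` the imaginary part says little, but then `1 - r ≥ 1/2` already forces `8(1 - x)
    -- > 1`.
    rcases le_total r (1 / 2) with hr | hr
    · have : S * ρ₀ ≤ 1 * 1 := by gcongr; linarith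
      linarith
    · have : S * ρ₀ * (1 / 2) ≤ S * x * r := by gcongr
      linarith
  · set u := ‖1 - tsujiRatio (polarPoint x φ) (polarPoint r θ)‖ with hu
    have hu3 : u ≤ 3 := by
      have := norm_sub_le 1 (tsujiRatio (polarPoint x φ) (polarPoint r θ))
      rw [norm_one] at this; linarith
    refine (abs_log_rpow_le (norm_nonneg _) hu3 hp).trans ?_
    have hu0 : ρ₀ ^ 2 * S / (4 * (1 - x)) ≤ u := by
      rw [hnorm]
      have : ρ₀ ^ 2 * S ≤ x * ‖polarPoint x φ - polarPoint r θ‖ := by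
        calc ρ₀ ^ 2 * S ≤ x ^ 2 * S := by gcongr
          _ = x * (x * S) := by ring
          _ ≤ _ := by gcongr
      gcongr
      linarith
    have h3u : 3 / u ≤ 12 / ρ₀ ^ 2 * (1 - x) * S⁻¹ := by
      have hpos' : 0 < ρ₀ ^ 2 * S / (4 * (1 - x)) := by positivity
      calc 3 / u ≤ 3 / (ρ₀ ^ 2 * S / (4 * (1 - x))) := by gcongr
        _ = _ := by field_simp; norm_num
    rw [mul_assoc, mul_assoc, ← mul_assoc ((12 / ρ₀ ^ 2) ^ (1 / 2 : ℝ)), Real.rpow_neg hS0.le,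
      ← Real.inv_rpow hS0.le, ← Real.mul_rpow (by positivity) hd.le,
      ← Real.mul_rpow (by positivity) (by positivity)]
    gcongr

lemma measurable_tsujiRatio (z : ℂ) : Measurable (tsujiRatio z) := by
  unfold tsujiRatio; fun_prop

lemma measurable_norm_tsujiRatio_polarPoint (z : ℂ) (r : ℝ) :
    Measurable fun θ => ‖tsujiRatio z (polarPoint r θ)‖ :=
  ((measurable_tsujiRatio z).comp (measurable_polarPoint r)).norm

lemma le_lintegral_norm_tsujiRatio_pow {z : ℂ} (hz : ‖z‖ < 1) {r : ℝ} (hr0 : 0 < r) (hr1 : r < 1)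
    (h : 1 - r ≤ 4 * (1 - ‖z‖)) (m : ℕ) :
    ENNReal.ofReal ((1 / 6) ^ m * (1 - ‖z‖)) ≤
      ∫⁻ θ in Set.Ioc 0 (2 * Real.pi), ENNReal.ofReal (‖tsujiRatio z (polarPoint r θ)‖ ^ m) := by
  obtain ⟨φ, hφ, hzφ⟩ := exists_eq_polarPoint z
  have hz0 := norm_nonneg z
  have hpt : ∀ θ, |θ - φ| ≤ 1 - ‖z‖ →
      ENNReal.ofReal ((1 / 6) ^ m) ≤ ENNReal.ofReal (‖tsujiRatio z (polarPoint r θ)‖ ^ m) := by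
    intro θ hθ
    refine ENNReal.ofReal_le_ofReal ?_
    gcongr
    have h1 := norm_one_sub_polarPoint_le (x := ‖z‖ * r) (by positivity) (by nlinarith) (θ - φ)
    have h0 := one_sub_le_norm_one_sub_conj_mul (z := z) (ζ := polarPoint r θ)
      (by rwa [norm_polarPoint hr0.le])
    rw [← conj_polarPoint_mul, ← hzφ] at h1
    rw [norm_tsujiRatio hz, le_div_iff₀ (by linarith)]
    nlinarith
  -- The arc goes to whichever side of `φ` keeps it inside one period. On it `|1 - z̄ζ| ≤ 6(1 -
  -- |z|)`: 1 and 4 from the two radii, 1 from the angle.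
  have hI : ∃ a, Set.Ioc a (a + (1 - ‖z‖)) ⊆ Set.Ioc 0 (2 * Real.pi) ∧
      ∀ θ ∈ Set.Ioc a (a + (1 - ‖z‖)), |θ - φ| ≤ 1 - ‖z‖ := by
    have hπ := Real.pi_gt_three
    rcases le_total φ Real.pi with hc | hc
    · refine ⟨φ, Set.Ioc_subset_Ioc hφ.1.le (by linarith), fun θ hθ => ?_⟩
      rw [abs_le]; constructor <;> linarith [hθ.1, hθ.2]
    · refine ⟨φ - (1 - ‖z‖), Set.Ioc_subset_Ioc (by linarith) (by linarith [hφ.2]), fun θ hθ => ?_⟩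
      rw [abs_le]; constructor <;> linarith [hθ.1, hθ.2]
  obtain ⟨a, hsub, hnear⟩ := hI
  calc ENNReal.ofReal ((1 / 6) ^ m * (1 - ‖z‖))
      = ∫⁻ _ in Set.Ioc a (a + (1 - ‖z‖)), ENNReal.ofReal ((1 / 6) ^ m) := by
        rw [setLIntegral_const, Real.volume_Ioc, ENNReal.ofReal_mul (by positivity)]
        congr 2; ring
    _ ≤ _ := setLIntegral_mono' measurableSet_Ioc fun θ hθ => hpt θ (hnear θ hθ)
    _ ≤ _ := lintegral_mono_set hsub

/-- The constant is uniform in the zero: one `√(1 - |z|)` comes from the pointwise bound and another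
from the truncated integral, matching the lower bound for the weight. -/
lemma exists_lintegral_near_le {ρ₀ p : ℝ} (hρ : 0 < ρ₀) (hp : 1 ≤ p) (m : ℕ) :
    ∃ C : ℝ, 0 ≤ C ∧ ∀ (z : ℂ) (r : ℝ), ρ₀ ≤ ‖z‖ → ‖z‖ < 1 → 0 < r → r < 1 →
      ∫⁻ θ in Set.Ioc 0 (2 * Real.pi), ENNReal.ofReal
        (if 1 / 2 < ‖tsujiRatio z (polarPoint r θ)‖ then
          |Real.log ‖1 - tsujiRatio z (polarPoint r θ)‖| ^ p else 0) ≤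
      ENNReal.ofReal C * ∫⁻ θ in Set.Ioc 0 (2 * Real.pi),
        ENNReal.ofReal (‖tsujiRatio z (polarPoint r θ)‖ ^ m) := by
  set A := (2 * p + 2) ^ p * (12 / ρ₀ ^ 2) ^ (1 / 2 : ℝ) with hA
  have hA0 : 0 ≤ A := by positivity
  refine ⟨A * (80 * (8 / ρ₀) ^ (1 / 2 : ℝ)) * 6 ^ m, by positivity, ?_⟩
  intro z r hz0 hz1 hr0 hr1
  have hd : 0 < 1 - ‖z‖ := by linarith
  by_cases hnear : 1 - r ≤ 4 * (1 - ‖z‖)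
  swap
  · refine le_trans (le_of_eq ?_) zero_le
    rw [lintegral_eq_zero_of_ae_eq_zero]
    refine Filter.Eventually.of_forall fun θ => ?_
    have : ¬ 1 / 2 < ‖tsujiRatio z (polarPoint r θ)‖ := by
      intro h
      have h1 := one_sub_le_four_mul_of_half_lt_norm_tsujiRatio hz1
        (by rwa [norm_polarPoint hr0.le]) h
      have h2 := one_sub_le_norm_one_sub_conj_mul' (ζ := polarPoint r θ) hz1
      rw [norm_polarPoint hr0.le] at h2
      linarith
    simp only [if_neg this, ENNReal.ofReal_zero, Pi.zero_apply]
  have hlow := le_lintegral_norm_tsujiRatio_pow hz1 hr0 hr1 hnear m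
  refine le_trans ?_ (mul_le_mul_right hlow _)
  obtain ⟨φ, hφ, hzφ⟩ := exists_eq_polarPoint z
  set d := 1 - ‖z‖
  calc _ ≤ ∫⁻ θ in Set.Ioc 0 (2 * Real.pi), ENNReal.ofReal (A * d ^ (1 / 2 : ℝ)) * ENNReal.ofReal
          (if |Real.sin (θ - φ)| ≤ 8 / ρ₀ * d then |Real.sin (θ - φ)| ^ (-(1 / 2) : ℝ) else 0) := by
        refine lintegral_mono_ae ?_
        filter_upwards [ae_restrict_of_ae (ae_sin_sub_ne_zero φ)] with θ hθ
        split_ifs with h1 h2 h2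
        · rw [← ENNReal.ofReal_mul (by positivity)]
          refine ENNReal.ofReal_le_ofReal ?_
          rw [hzφ] at h1
          have := (abs_log_rpow_le_of_half_lt_norm_tsujiRatio hρ hz0 hz1 hr0 hr1 hp hθ h1).2
          rwa [← hzφ] at this
        · rw [hzφ] at h1
          exact absurd (abs_log_rpow_le_of_half_lt_norm_tsujiRatio hρ hz0 hz1 hr0 hr1 hp hθ h1).1 h2
        · simp
        · simp
    _ ≤ ENNReal.ofReal (A * d ^ (1 / 2 : ℝ)) *
          ENNReal.ofReal (80 * (8 / ρ₀ * d) ^ (1 / 2 : ℝ)) := by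
        rw [lintegral_const_mul' _ _ ENNReal.ofReal_ne_top]
        exact mul_le_mul_right (lintegral_truncated_abs_sin_rpow_le hφ (by positivity)) _
    _ = _ := by
        rw [← ENNReal.ofReal_mul (by positivity), ← ENNReal.ofReal_mul (by positivity)]
        congr 1
        rw [Real.mul_rpow (by positivity) hd.le]
        have h1 : d ^ (1 / 2 : ℝ) * d ^ (1 / 2 : ℝ) = d := by
          rw [← Real.rpow_add hd]; norm_num
        have h2 : (6 : ℝ) ^ m * (1 / 6) ^ m = 1 := by rw [← mul_pow]; norm_num
        linear_combination (A * (80 * (8 / ρ₀) ^ (1 / 2 : ℝ))) * h1 -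
          (A * (80 * (8 / ρ₀) ^ (1 / 2 : ℝ)) * d) * h2

/-! ### From single factors to the canonical product -/

lemma measurable_logFactorRatio (q : ℕ) : Measurable (logFactorRatio q) := by
  unfold logFactorRatio
  refine measurable_const.mul (measurable_const.add (Measurable.ite ?_ ?_ measurable_const))
  · exact measurableSet_lt measurable_const measurable_norm
  · have h : Measurable fun w : ℂ => Real.log ‖1 - w‖ := by fun_prop
    exact h.abs

lemma logFactorRatio_nonneg (q : ℕ) (w : ℂ) : 0 ≤ logFactorRatio q w := by
  unfold logFactorRatio
  split_ifs <;> positivity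

lemma pow_mul_logFactorRatio_rpow_le (q : ℕ) {w : ℂ} (hw : ‖w‖ ≤ 2) {p : ℝ} (hp : 1 ≤ p) :
    ‖w‖ ^ (q + 1) * logFactorRatio q w ^ p ≤
      (2 ^ (q + 1) * (1 + q * 2 ^ q) * 2) ^ p * (‖w‖ ^ (q + 1) +
        2 ^ (q + 1) * if 1 / 2 < ‖w‖ then |Real.log ‖1 - w‖| ^ p else 0) := by
  have hp0 : 0 < p := by linarith
  set ℓ : ℝ := if 1 / 2 < ‖w‖ then |Real.log ‖1 - w‖| else 0 with hℓ
  have hℓ0 : 0 ≤ ℓ := by rw [hℓ]; split_ifs <;> positivity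
  have hℓp : (if 1 / 2 < ‖w‖ then |Real.log ‖1 - w‖| ^ p else 0) = ℓ ^ p := by
    rw [hℓ]; split_ifs
    · rfl
    · rw [Real.zero_rpow hp0.ne']
  have hadd : (1 + ℓ) ^ p ≤ 2 ^ p * (1 + ℓ ^ p) := by
    rcases le_total ℓ 1 with h | h
    · calc (1 + ℓ) ^ p ≤ 2 ^ p := by gcongr; linarith
        _ ≤ 2 ^ p * (1 + ℓ ^ p) := by
          refine le_mul_of_one_le_right (by positivity) ?_
          linarith [Real.rpow_nonneg hℓ0 p]
    · calc (1 + ℓ) ^ p ≤ (2 * ℓ) ^ p := by gcongr; linarith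
        _ = 2 ^ p * ℓ ^ p := Real.mul_rpow (by norm_num) hℓ0
        _ ≤ 2 ^ p * (1 + ℓ ^ p) := by gcongr; linarith
  have hwq : ‖w‖ ^ (q + 1) ≤ 2 ^ (q + 1) := by gcongr
  rw [hℓp, logFactorRatio, ← hℓ, Real.mul_rpow (by positivity) (by positivity),
    Real.mul_rpow (z := p) (show (0 : ℝ) ≤ 2 ^ (q + 1) * (1 + q * 2 ^ q) by positivity)
      (by norm_num : (0 : ℝ) ≤ 2)]
  set D := ((2 : ℝ) ^ (q + 1) * (1 + q * 2 ^ q)) ^ p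
  have hD : 0 ≤ D := by positivity
  calc ‖w‖ ^ (q + 1) * (D * (1 + ℓ) ^ p)
      ≤ ‖w‖ ^ (q + 1) * (D * (2 ^ p * (1 + ℓ ^ p))) := by gcongr
    _ = D * 2 ^ p * (‖w‖ ^ (q + 1) + ‖w‖ ^ (q + 1) * ℓ ^ p) := by ring
    _ ≤ _ := by gcongr

lemma exists_lintegral_logFactorRatio_le {ρ₀ p : ℝ} (hρ : 0 < ρ₀) (hp : 1 ≤ p) (q : ℕ) :
    ∃ C : ℝ, 0 < C ∧ ∀ (z : ℂ) (r : ℝ), ρ₀ ≤ ‖z‖ → ‖z‖ < 1 → 0 < r → r < 1 →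
      ∫⁻ θ in Set.Ioc 0 (2 * Real.pi),
        ENNReal.ofReal (‖tsujiRatio z (polarPoint r θ)‖ ^ (q + 1)) *
          ENNReal.ofReal (logFactorRatio q (tsujiRatio z (polarPoint r θ))) ^ p ≤
      ENNReal.ofReal C * ∫⁻ θ in Set.Ioc 0 (2 * Real.pi),
        ENNReal.ofReal (‖tsujiRatio z (polarPoint r θ)‖ ^ (q + 1)) := by
  obtain ⟨C, hC0, hC⟩ := exists_lintegral_near_le hρ hp (q + 1)
  have hp0 : 0 < p := by linarith
  set D := ((2 : ℝ) ^ (q + 1) * (1 + q * 2 ^ q) * 2) ^ p with hD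
  have hD0 : 0 < D := by positivity
  refine ⟨D * (1 + 2 ^ (q + 1) * C), by positivity, fun z r hz0 hz1 hr0 hr1 => ?_⟩
  set N : ℝ → ℝ := fun θ => if 1 / 2 < ‖tsujiRatio z (polarPoint r θ)‖ then
    |Real.log ‖1 - tsujiRatio z (polarPoint r θ)‖| ^ p else 0 with hN
  have hN0 : ∀ θ, 0 ≤ N θ := fun θ => by simp only [hN]; split_ifs <;> positivity
  have hm := measurable_norm_tsujiRatio_polarPoint z r
  set J := ∫⁻ θ in Set.Ioc 0 (2 * Real.pi),
        ENNReal.ofReal (‖tsujiRatio z (polarPoint r θ)‖ ^ (q + 1))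
  calc _ ≤ ∫⁻ θ in Set.Ioc 0 (2 * Real.pi), ENNReal.ofReal D *
        (ENNReal.ofReal (‖tsujiRatio z (polarPoint r θ)‖ ^ (q + 1)) +
          ENNReal.ofReal (2 ^ (q + 1)) * ENNReal.ofReal (N θ)) := by
        refine lintegral_mono fun θ => ?_
        rw [ENNReal.ofReal_rpow_of_nonneg (logFactorRatio_nonneg _ _) hp0.le,
          ← ENNReal.ofReal_mul (by positivity), ← ENNReal.ofReal_mul (by positivity),
          ← ENNReal.ofReal_add (by positivity) (mul_nonneg (by positivity) (hN0 θ)),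
          ← ENNReal.ofReal_mul hD0.le]
        exact ENNReal.ofReal_le_ofReal (pow_mul_logFactorRatio_rpow_le q
          (norm_tsujiRatio_le hz1 (by rwa [norm_polarPoint hr0.le])) hp)
    _ = ENNReal.ofReal D * (J + ENNReal.ofReal (2 ^ (q + 1)) *
          ∫⁻ θ in Set.Ioc 0 (2 * Real.pi), ENNReal.ofReal (N θ)) := by
        rw [lintegral_const_mul' _ _ ENNReal.ofReal_ne_top,
          lintegral_add_left (hm.pow_const _).ennreal_ofReal,
          lintegral_const_mul' _ _ ENNReal.ofReal_ne_top]
    _ ≤ ENNReal.ofReal D * (J + ENNReal.ofReal (2 ^ (q + 1)) * (ENNReal.ofReal C * J)) := by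
        gcongr
        exact hC z r hz0 hz1 hr0 hr1
    _ = _ := by
        rw [ENNReal.ofReal_mul hD0.le, ENNReal.ofReal_add zero_le_one (by positivity),
          ENNReal.ofReal_mul (by positivity), ENNReal.ofReal_one]
        ring

/-- No convergence is needed: a divergent product is 1 by default and a zero product has `Real.log 0
= 0`, so both give 0 on the left. -/
lemma ofReal_abs_log_norm_tprod_le {ι : Type*} (f : ι → ℂ) :
    ENNReal.ofReal |Real.log ‖∏' n, f n‖| ≤ ∑' n, ENNReal.ofReal |Real.log ‖f n‖| := by
  by_cases hf : Multipliable f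
  swap
  · simp [tprod_eq_one_of_not_multipliable hf]
  by_cases h0 : ∏' n, f n = 0
  · simp [h0]
  have hfin : ∀ t : Finset ι, ENNReal.ofReal |Real.log ‖∏ n ∈ t, f n‖| ≤
      ∑' n, ENNReal.ofReal |Real.log ‖f n‖| := by
    intro t
    refine le_trans ?_ (ENNReal.sum_le_tsum t)
    rw [← ENNReal.ofReal_sum_of_nonneg fun _ _ => abs_nonneg _]
    refine ENNReal.ofReal_le_ofReal ?_
    by_cases ht : ∏ n ∈ t, f n = 0
    · rw [ht, norm_zero, Real.log_zero, abs_zero]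
      exact Finset.sum_nonneg fun _ _ => abs_nonneg _
    · rw [norm_prod, Real.log_prod fun n hn => norm_ne_zero_iff.2 (Finset.prod_ne_zero_iff.1 ht n hn)]
      exact Finset.abs_sum_le_sum_abs _ _
  have hprod : Filter.Tendsto (fun t : Finset ι => ∏ n ∈ t, f n) Filter.atTop
      (nhds (∏' n, f n)) := hf.hasProd
  have hlim := ENNReal.tendsto_ofReal (hprod.norm.log (norm_ne_zero_iff.2 h0)).abs
  exact le_of_tendsto hlim (Filter.Eventually.of_forall hfin)

/-- Only finitely many points lie in `|z| ≤ 1/2`, since each contributes at least `2^(-m)` to the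
sum. -/
lemma exists_pos_le_norm_of_summable {ι : Type*} {z : ι → ℂ} (hz0 : ∀ n, z n ≠ 0) {m : ℕ}
    (hsum : Summable fun n => (1 - ‖z n‖) ^ m) : ∃ ρ : ℝ, 0 < ρ ∧ ∀ n, ρ ≤ ‖z n‖ := by
  have hfin : {n | ‖z n‖ ≤ 1 / 2}.Finite := by
    have h := hsum.tendsto_cofinite_zero.eventually_lt_const (show (0 : ℝ) < (1 / 2) ^ m by positivity)
    refine Set.Finite.subset (Filter.eventually_cofinite.1 h) fun n hn => ?_
    simp only [Set.mem_ofPred_eq, not_lt] at hn ⊢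
    exact pow_le_pow_left₀ (by norm_num) (by linarith) _
  obtain ⟨b, hb⟩ := (hfin.image fun n => ‖z n‖⁻¹).bddAbove
  refine ⟨min (1 / 2) (|b| + 1)⁻¹, by positivity, fun n => ?_⟩
  rcases le_total ‖z n‖ (1 / 2) with h | h
  · refine (min_le_right _ _).trans ?_
    have hpos := norm_pos_iff.2 (hz0 n)
    rw [inv_le_comm₀ (by positivity) hpos]
    linarith [hb ⟨n, h, rfl⟩, le_abs_self b]
  · exact (min_le_left _ _).trans h

lemma exists_logMean_canonicalProduct_le {ι : Type*} [Countable ι] {z : ι → ℂ}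
    (hz : ∀ n, ‖z n‖ < 1) (hz0 : ∀ n, z n ≠ 0) {s : ℕ}
    (hsum : Summable fun n => (1 - ‖z n‖) ^ (s + 1)) {γ : ℝ} (hγ1 : γ ≤ (s : ℝ) + 1)
    (hC : CarlesonCondition z s γ) {p : ℝ} (hp : 1 ≤ p) :
    ∃ C : ℝ, 0 < C ∧ ∀ r : ℝ, 0 < r → r < 1 → logMean p r (canonicalProduct z s) ≤
      ENNReal.ofReal (C * (1 - r) ^ (γ - (s : ℝ) - 1) * (Real.log (1 / (1 - r)) + 1)) := by
  obtain ⟨C₀, hC₀, hM⟩ := exists_tsum_norm_tsujiRatio_pow_le hz hsum hγ1 hC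
  obtain ⟨ρ, hρ, hzρ⟩ := exists_pos_le_norm_of_summable hz0 hsum
  obtain ⟨C, hC0, hCint⟩ := exists_lintegral_logFactorRatio_le hρ hp s
  have hp0 : 0 < p := by linarith
  refine ⟨C ^ (1 / p) * C₀, by positivity, fun r hr0 hr1 => ?_⟩
  set M := C₀ * ((1 - r) ^ (γ - s - 1) * (Real.log (1 / (1 - r)) + 1)) with hMdef
  have hint := lintegral_tsum_mul_rpow_le (μ := volume.restrict (Set.Ioc 0 (2 * Real.pi)))
    (a := fun n θ => ENNReal.ofReal (‖tsujiRatio (z n) (polarPoint r θ)‖ ^ (s + 1)))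
    (h := fun n θ => ENNReal.ofReal (logFactorRatio s (tsujiRatio (z n) (polarPoint r θ))))
    (fun n => ((measurable_norm_tsujiRatio_polarPoint (z n) r).pow_const _).ennreal_ofReal)
    (fun n => ((measurable_logFactorRatio s).comp ((measurable_tsujiRatio (z n)).comp
      (measurable_polarPoint r))).ennreal_ofReal) hp
    (fun θ => hM r θ hr0 hr1) (fun n => hCint (z n) r (hzρ n) (hz n) hr0 hr1)
  rw [Measure.restrict_apply_univ, Real.volume_Ioc, sub_zero] at hint
  have hpt : ∀ θ, ENNReal.ofReal (|Real.log ‖canonicalProduct z s (polarPoint r θ)‖| ^ p) ≤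
      (∑' n, ENNReal.ofReal (‖tsujiRatio (z n) (polarPoint r θ)‖ ^ (s + 1)) *
        ENNReal.ofReal (logFactorRatio s (tsujiRatio (z n) (polarPoint r θ)))) ^ p := by
    intro θ
    rw [← ENNReal.ofReal_rpow_of_nonneg (abs_nonneg _) hp0.le]
    refine ENNReal.rpow_le_rpow ?_ hp0.le
    refine (ofReal_abs_log_norm_tprod_le _).trans (ENNReal.tsum_le_tsum fun n => ?_)
    rw [← ENNReal.ofReal_mul (by positivity)]
    exact ENNReal.ofReal_le_ofReal (abs_log_norm_elementaryFactor_le_mul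
      (norm_tsujiRatio_le (hz n) (by rwa [norm_polarPoint hr0.le])) s)
  have h2π : ENNReal.ofReal (2 * Real.pi) ≠ 0 := by simp [Real.pi_pos]
  calc logMean p r (canonicalProduct z s)
      ≤ (ENNReal.ofReal C * ENNReal.ofReal M ^ p * ENNReal.ofReal (2 * Real.pi) /
          ENNReal.ofReal (2 * Real.pi)) ^ (1 / p) := by
        refine ENNReal.rpow_le_rpow ?_ (by positivity)
        exact ENNReal.div_le_div_right ((lintegral_mono hpt).trans hint) _
    _ = ENNReal.ofReal (C ^ (1 / p)) * ENNReal.ofReal M := by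
        rw [ENNReal.mul_div_cancel_right h2π ENNReal.ofReal_ne_top,
          ENNReal.mul_rpow_of_nonneg _ _ (by positivity), ← ENNReal.rpow_mul,
          mul_one_div_cancel hp0.ne', ENNReal.rpow_one,
          ENNReal.ofReal_rpow_of_nonneg hC0.le (by positivity)]
    _ = _ := by
        rw [← ENNReal.ofReal_mul (by positivity), hMdef]
        congr 1; ring

/-! ### The converse for Blaschke products -/

lemma sq_norm_one_sub_conj_mul_sub_sq_norm_sub (z ζ : ℂ) :
    ‖1 - starRingEnd ℂ z * ζ‖ ^ 2 - ‖z - ζ‖ ^ 2 = (1 - ‖z‖ ^ 2) * (1 - ‖ζ‖ ^ 2) := by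
  simp only [← Complex.normSq_eq_norm_sq, Complex.normSq_apply, Complex.sub_re, Complex.sub_im,
    Complex.mul_re, Complex.mul_im, Complex.conj_re, Complex.conj_im, Complex.one_re, Complex.one_im]
  ring

/-- A single factor of the Blaschke product. -/
noncomputable def blaschkeFactor (z ζ : ℂ) : ℂ :=
  (starRingEnd ℂ z * (z - ζ)) / ((‖z‖ : ℂ) * (1 - starRingEnd ℂ z * ζ))

lemma norm_blaschkeFactor {z : ℂ} (hz0 : z ≠ 0) (ζ : ℂ) :
    ‖blaschkeFactor z ζ‖ = ‖z - ζ‖ / ‖1 - starRingEnd ℂ z * ζ‖ := by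
  rw [blaschkeFactor, norm_div, norm_mul, norm_mul, Complex.norm_conj, Complex.norm_real, norm_norm,
    mul_div_mul_left _ _ (norm_ne_zero_iff.2 hz0)]

lemma one_sub_sq_norm_blaschkeFactor {z ζ : ℂ} (hz0 : z ≠ 0) (hz : ‖z‖ < 1) (hζ : ‖ζ‖ < 1) :
    1 - ‖blaschkeFactor z ζ‖ ^ 2 =
      (1 - ‖z‖ ^ 2) * (1 - ‖ζ‖ ^ 2) / ‖1 - starRingEnd ℂ z * ζ‖ ^ 2 := by
  have h := one_sub_le_norm_one_sub_conj_mul (z := z) hζ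
  have hx : ‖1 - starRingEnd ℂ z * ζ‖ ^ 2 ≠ 0 := by
    have : 0 < ‖1 - starRingEnd ℂ z * ζ‖ := by linarith
    positivity
  rw [norm_blaschkeFactor hz0, div_pow, ← sq_norm_one_sub_conj_mul_sub_sq_norm_sub, sub_div,
    div_self hx]

lemma norm_blaschkeFactor_sub_one_le {z ζ : ℂ} (hz0 : z ≠ 0) (hz : ‖z‖ < 1) (hζ : ‖ζ‖ < 1) :
    ‖blaschkeFactor z ζ - 1‖ ≤ 2 / (1 - ‖ζ‖) * (1 - ‖z‖) := by
  have h := one_sub_le_norm_one_sub_conj_mul' (ζ := ζ) hz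
  have hne : 1 - starRingEnd ℂ z * ζ ≠ 0 := norm_pos_iff.1 (by linarith)
  have hzn : (‖z‖ : ℂ) ≠ 0 := by exact_mod_cast norm_ne_zero_iff.2 hz0
  have heq : blaschkeFactor z ζ - 1 =
      -((1 - ‖z‖ : ℝ) : ℂ) * ((‖z‖ : ℂ) + starRingEnd ℂ z * ζ) /
        ((‖z‖ : ℂ) * (1 - starRingEnd ℂ z * ζ)) := by
    rw [blaschkeFactor, div_sub_one (mul_ne_zero hzn hne)]
    congr 1
    have h2 := Complex.conj_mul' z
    push_cast
    linear_combination h2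
  have hpos : 0 < ‖z‖ := norm_pos_iff.2 hz0
  have hsum : ‖(‖z‖ : ℂ) + starRingEnd ℂ z * ζ‖ ≤ 2 * ‖z‖ := by
    refine (norm_add_le _ _).trans ?_
    rw [norm_mul, Complex.norm_conj, Complex.norm_real, norm_norm]
    nlinarith
  have hd : 0 < 1 - ‖ζ‖ := by linarith
  have hd' : 0 ≤ 1 - ‖z‖ := by linarith
  rw [heq, norm_div, norm_mul, norm_mul, norm_neg, Complex.norm_real, Complex.norm_real, norm_norm,
    Real.norm_of_nonneg hd']
  calc _ ≤ (1 - ‖z‖) * (2 * ‖z‖) / (‖z‖ * (1 - ‖ζ‖)) := by gcongr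
    _ = _ := by field_simp

/-- Factors have modulus at most 1, so the product is at most any partial product, and `-log|b| ≥ (1
- |b|²)/2`. For a lower bound the default values would be fatal, hence the proofs of convergence and
of `B ≠ 0`. -/
lemma sum_le_abs_log_norm_blaschkeProduct {ι : Type*} {z : ι → ℂ} (hz : ∀ n, ‖z n‖ < 1)
    (hz0 : ∀ n, z n ≠ 0) (hsum : Summable fun n => 1 - ‖z n‖) {ζ : ℂ} (hζ : ‖ζ‖ < 1)
    (hne : ∀ n, z n ≠ ζ) (t : Finset ι) :
    ∑ n ∈ t, (1 - ‖blaschkeFactor (z n) ζ‖ ^ 2) / 2 ≤ |Real.log ‖blaschkeProduct z ζ‖| := by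
  set b : ι → ℂ := fun n => blaschkeFactor (z n) ζ with hb
  have hbs : Summable fun n => ‖b n - 1‖ :=
    Summable.of_nonneg_of_le (fun _ => norm_nonneg _)
      (fun n => norm_blaschkeFactor_sub_one_le (hz0 n) (hz n) hζ) (hsum.mul_left _)
  have hx : ∀ n, 0 < ‖1 - starRingEnd ℂ (z n) * ζ‖ := fun n => by
    linarith [one_sub_le_norm_one_sub_conj_mul (z := z n) hζ, hz n]
  have hb0 : ∀ n, b n ≠ 0 := fun n => by
    rw [← norm_ne_zero_iff, hb]
    simp only [norm_blaschkeFactor (hz0 n)]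
    exact div_ne_zero (norm_ne_zero_iff.2 (sub_ne_zero.2 (hne n))) (hx n).ne'
  have hb1 : ∀ n, ‖b n‖ ≤ 1 := fun n => by
    have h1 := one_sub_sq_norm_blaschkeFactor (hz0 n) (hz n) hζ
    have h2 : 0 ≤ (1 - ‖z n‖ ^ 2) * (1 - ‖ζ‖ ^ 2) / ‖1 - starRingEnd ℂ (z n) * ζ‖ ^ 2 := by
      have := hz n
      refine div_nonneg (mul_nonneg ?_ ?_) (by positivity) <;>
        nlinarith [norm_nonneg (z n), norm_nonneg ζ]
    have h3 : ‖b n‖ ^ 2 ≤ 1 := by simp only [hb]; linarith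
    exact (sq_le_one_iff₀ (norm_nonneg _)).1 h3
  have hmul : Multipliable b := by
    simpa using multipliable_one_add_of_summable hbs
  have hB0 : ∏' n, b n ≠ 0 := by
    simpa using tprod_one_add_ne_zero_of_summable (f := fun n => b n - 1)
      (fun n => by simpa using hb0 n) hbs
  have hle : ‖∏' n, b n‖ ≤ ∏ n ∈ t, ‖b n‖ := by
    classical
    refine le_of_tendsto hmul.hasProd.norm ?_
    filter_upwards [Filter.eventually_ge_atTop t] with t' ht'
    rw [← Finset.prod_sdiff ht']
    exact mul_le_of_le_one_left (Finset.prod_nonneg fun _ _ => norm_nonneg _)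
      (Finset.prod_le_one (fun _ _ => norm_nonneg _) fun n _ => hb1 n)
  have hlog := Real.log_le_log (norm_pos_iff.2 hB0) hle
  rw [Real.log_prod fun n _ => norm_ne_zero_iff.2 (hb0 n)] at hlog
  calc ∑ n ∈ t, (1 - ‖b n‖ ^ 2) / 2 ≤ ∑ n ∈ t, -Real.log ‖b n‖ := by
        refine Finset.sum_le_sum fun n _ => ?_
        have hp : 0 < ‖b n‖ := norm_pos_iff.2 (hb0 n)
        have := Real.log_le_sub_one_of_pos (pow_pos hp 2)
        rw [Real.log_pow] at this
        push_cast at this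
        linarith
    _ = -∑ n ∈ t, Real.log ‖b n‖ := Finset.sum_neg_distrib _
    _ ≤ -Real.log ‖∏' n, b n‖ := by linarith
    _ ≤ _ := neg_le_abs _

/-- The `p`-th mean is at least `G c^(1/p)`, where `c` is the normalized length of the arc, and
`c^(1/p) → 1`. -/
lemma le_of_forall_logMean_le {f : ℂ → ℂ} {r a b G L : ℝ} (hab : a < b) (ha : 0 ≤ a)
    (hb : b ≤ 2 * Real.pi) (hG : 0 ≤ G) (hL : 0 ≤ L)
    (hlow : ∀ᵐ θ : ℝ, θ ∈ Set.Ioc a b → G ≤ |Real.log ‖f (polarPoint r θ)‖|)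
    (hmean : ∀ p : ℝ, 1 ≤ p → logMean p r f ≤ ENNReal.ofReal L) : G ≤ L := by
  have hπ := Real.two_pi_pos
  set c := (b - a) / (2 * Real.pi) with hc
  have hc0 : 0 < c := div_pos (sub_pos.2 hab) hπ
  have hp : ∀ p : ℝ, 1 ≤ p → G * c ^ (1 / p) ≤ L := by
    intro p hp
    have hp0 : 0 < p := by linarith
    have h1 : ENNReal.ofReal (G ^ p * (b - a)) ≤ ∫⁻ θ in Set.Ioc 0 (2 * Real.pi),
        ENNReal.ofReal (|Real.log ‖f (polarPoint r θ)‖| ^ p) := by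
      calc ENNReal.ofReal (G ^ p * (b - a)) = ∫⁻ _ in Set.Ioc a b, ENNReal.ofReal (G ^ p) := by
            rw [setLIntegral_const, Real.volume_Ioc, ENNReal.ofReal_mul (by positivity)]
        _ ≤ ∫⁻ θ in Set.Ioc a b, ENNReal.ofReal (|Real.log ‖f (polarPoint r θ)‖| ^ p) := by
            refine lintegral_mono_ae ((ae_restrict_iff' measurableSet_Ioc).2 ?_)
            filter_upwards [hlow] with θ hθ hmem
            have := hθ hmem
            exact ENNReal.ofReal_le_ofReal (by gcongr)
        _ ≤ _ := lintegral_mono_set (Set.Ioc_subset_Ioc ha hb)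
    have h2 : ENNReal.ofReal (G * c ^ (1 / p)) ≤ ENNReal.ofReal L := by
      refine le_trans ?_ (hmean p hp)
      refine le_trans (le_of_eq ?_)
        (ENNReal.rpow_le_rpow (ENNReal.div_le_div_right h1 _) (by positivity))
      rw [← ENNReal.ofReal_div_of_pos hπ, mul_div_assoc, ← hc,
        ENNReal.ofReal_rpow_of_nonneg (by positivity) (by positivity),
        Real.mul_rpow (by positivity) hc0.le, ← Real.rpow_mul hG, mul_one_div_cancel hp0.ne',
        Real.rpow_one]
    exact (ENNReal.ofReal_le_ofReal_iff hL).1 h2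
  have hlim : Filter.Tendsto (fun p : ℝ => G * c ^ (1 / p)) Filter.atTop (nhds (G * c ^ (0 : ℝ))) := by
    refine Filter.Tendsto.const_mul _ (Filter.Tendsto.rpow tendsto_const_nhds ?_ (Or.inl hc0.ne'))
    exact tendsto_inv_atTop_zero.congr fun p : ℝ => (one_div p).symm
  rw [Real.rpow_zero, mul_one] at hlim
  exact le_of_tendsto hlim ((Filter.eventually_ge_atTop 1).mono hp)

/-- Discards the angles at which `B` vanishes, where `log|B|` takes the default value 0. -/
lemma ae_ne_polarPoint {ι : Type*} [Countable ι] (z : ι → ℂ) {r : ℝ} (hr : r ≠ 0) :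
    ∀ᵐ θ : ℝ, ∀ n, z n ≠ polarPoint r θ := by
  have hc : (Complex.exp ⁻¹' Set.range fun n => z n / r).Countable :=
    Complex.countable_preimage_exp.2 (Set.countable_range _)
  have hinj : Function.Injective fun θ : ℝ => (θ : ℂ) * Complex.I := fun x y h => by
    exact_mod_cast mul_right_cancel₀ Complex.I_ne_zero h
  filter_upwards [(hc.preimage hinj).ae_notMem volume] with θ hθ n hn
  refine hθ ⟨n, ?_⟩
  simp only [hn, polarPoint]
  rw [mul_div_cancel_left₀ _ (by exact_mod_cast hr)]

lemma norm_one_sub_conj_mul_polarPoint_le {φ δ : ℝ} {z : ℂ}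
    (hz : z ∈ carlesonSquare φ δ) (hδ : δ < 1) {r θ : ℝ} (hr0 : 0 ≤ r) (hr1 : r < 1)
    (hr : 1 - r ≤ δ) (hθ : |θ - φ| ≤ δ) :
    ‖1 - starRingEnd ℂ z * polarPoint r θ‖ ≤ 7 * δ := by
  obtain ⟨ρ, α, h1, h2, h3, h4, rfl⟩ := hz
  have hρ : 0 ≤ ρ := by linarith
  have h5 := norm_one_sub_polarPoint_le (x := ρ * r) (by positivity) (by nlinarith) (θ - α)
  rw [← conj_polarPoint_mul, polarPoint] at h5
  -- The 4 replaces `π`; with `1 - ρr ≤ 2δ` the total is `7δ`.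
  have h6 : |θ - α| ≤ δ + 4 * δ := by
    have : |φ - α| ≤ 4 * δ := by
      have := Real.pi_le_four
      rw [abs_le]; constructor <;> nlinarith
    have h7 := abs_add_le (θ - φ) (φ - α)
    rw [sub_add_sub_cancel] at h7
    linarith
  nlinarith

lemma carlesonCondition_of_logMean_blaschkeProduct_le {ι : Type*} [Countable ι] {z : ι → ℂ}
    (hz : ∀ n, ‖z n‖ < 1) (hz0 : ∀ n, z n ≠ 0) (hsum : Summable fun n => 1 - ‖z n‖) {γ : ℝ}
    (hγ1 : γ ≤ 1) {R : Set ℝ} (hR : R ⊆ Set.Ioo 0 1) {q : ℝ} (hq0 : 0 < q)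
    (hq : ∀ t : ℝ, 0 < t → t < 1 → ∃ r ∈ R, q * t ≤ 1 - r ∧ 1 - r ≤ t) {K : ℝ}
    (hK : ∀ p : ℝ, 1 ≤ p → ∀ r ∈ R,
      logMean p r (blaschkeProduct z) ≤ ENNReal.ofReal (K * (1 - r) ^ (γ - 1))) :
    CarlesonCondition z 0 γ := by
  refine ⟨98 / q * |K| * q ^ (γ - 1), fun φ δ hδ0 hδ1 => ?_⟩
  obtain ⟨r, hrR, hr1, hr2⟩ := hq δ hδ0 hδ1
  obtain ⟨hr0, hr01⟩ := hR hrR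
  refine Real.tsum_le_of_sum_le (fun n => pow_nonneg (sub_nonneg.2 (hz _).le) _) fun t => ?_
  simp only [zero_add, pow_one]
  set T := ∑ n ∈ t, (1 - ‖z n‖) with hT
  have hT0 : 0 ≤ T := Finset.sum_nonneg fun n _ => sub_nonneg.2 (hz _).le
  obtain ⟨k, hk⟩ := exists_add_int_mul_two_pi_mem_Ioc φ
  set φ' := φ + k * (2 * Real.pi) with hφ'
  have hqd : 0 < q * δ := by positivity
  -- Here 98 is `2 · 7²`: the half from the logarithm and the squared `7δ`; `q` comes from `1 - r ≥
  -- qδ`. The arc lies to the left of `φ'` and is cut at 0 to stay within the period.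
  have hG : T * (q / (98 * δ)) ≤ |K| * (q * δ) ^ (γ - 1) := by
    refine le_of_forall_logMean_le (f := blaschkeProduct z) (r := r) (a := max 0 (φ' - δ)) (b := φ')
      (max_lt hk.1 (by linarith)) (le_max_left _ _) hk.2 (by positivity) (by positivity) ?_ ?_
    · filter_upwards [ae_ne_polarPoint z hr0.ne'] with θ hθ hmem
      have hζ : ‖polarPoint r θ‖ < 1 := by rwa [norm_polarPoint hr0.le]
      have h1 := sum_le_abs_log_norm_blaschkeProduct hz hz0 hsum hζ hθ
        (t.map (Function.Embedding.subtype _))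
      refine le_trans ?_ h1
      rw [Finset.sum_map, hT, Finset.sum_mul]
      refine Finset.sum_le_sum fun n _ => ?_
      simp only [Function.Embedding.subtype_apply]
      rw [one_sub_sq_norm_blaschkeFactor (hz0 _) (hz _) hζ, norm_polarPoint hr0.le]
      have hθφ : |θ + (-k : ℤ) * (2 * Real.pi) - φ| ≤ δ := by
        have := (max_lt_iff.1 hmem.1).2
        have := hmem.2
        push_cast
        rw [abs_le]; constructor <;> linarith
      have h7 := norm_one_sub_conj_mul_polarPoint_le n.2 hδ1 hr0.le hr01 hr2 hθφ
      rw [polarPoint_add_int_mul_two_pi] at h7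
      have hx := one_sub_le_norm_one_sub_conj_mul (z := z n) hζ
      have hzn := hz n
      have hz00 := norm_nonneg (z n)
      set x := ‖1 - starRingEnd ℂ (z n) * polarPoint r θ‖
      have hx0 : 0 < x := by linarith
      calc (1 - ‖z n‖) * (q / (98 * δ)) = (1 - ‖z n‖) * (q * δ) / (7 * δ) ^ 2 / 2 := by
            field_simp; ring
        _ ≤ (1 - ‖z n‖ ^ 2) * (1 - r ^ 2) / x ^ 2 / 2 := by
            have e1 : 1 - ‖z n‖ ≤ 1 - ‖z n‖ ^ 2 := by nlinarith
            have e2 : q * δ ≤ 1 - r ^ 2 := by nlinarith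
            have e3 : 0 ≤ 1 - ‖z n‖ ^ 2 := by linarith
            have e4 : 0 ≤ 1 - r ^ 2 := by linarith
            gcongr
    · intro p hp
      refine (hK p hp r hrR).trans (ENNReal.ofReal_le_ofReal ?_)
      have h1 : (1 - r) ^ (γ - 1) ≤ (q * δ) ^ (γ - 1) :=
        Real.rpow_le_rpow_of_nonpos hqd hr1 (by linarith)
      have h2 : 0 ≤ (1 - r) ^ (γ - 1) := Real.rpow_nonneg (by linarith) _
      calc K * (1 - r) ^ (γ - 1) ≤ |K| * (1 - r) ^ (γ - 1) := by gcongr; exact le_abs_self K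
        _ ≤ _ := by gcongr
  have hpow : δ ^ γ = δ ^ (γ - 1) * δ := by
    rw [← Real.rpow_add_one hδ0.ne']; congr 1; ring
  rw [Real.mul_rpow hq0.le hδ0.le] at hG
  calc T = T * (q / (98 * δ)) * (98 * δ / q) := by field_simp
    _ ≤ |K| * (q ^ (γ - 1) * δ ^ (γ - 1)) * (98 * δ / q) := by gcongr
    _ = _ := by rw [hpow]; ring

end

theorem theorem1 {ι : Type*} [Countable ι] (z : ι → ℂ)
    (hz : ∀ n, ‖z n‖ < 1) (hz0 : ∀ n, z n ≠ 0)
    (s : ℕ) (hsum : Summable fun n => (1 - ‖z n‖) ^ (s + 1))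
    (γ : ℝ) (hγ0 : 0 < γ) (hγ1 : γ ≤ (s : ℝ) + 1) :
    (CarlesonCondition z s γ → ∀ p : ℝ, 1 ≤ p →
      (γ < (s : ℝ) + 1 → ∃ C₂ : ℝ, 0 < C₂ ∧ ∀ r : ℝ, 0 < r → r < 1 →
        logMean p r (canonicalProduct z s) ≤
          ENNReal.ofReal (C₂ * (1 - r) ^ (γ - (s : ℝ) - 1) * (Real.log (1 / (1 - r)) + 1))) ∧
      (γ = (s : ℝ) + 1 → ∃ C₂ : ℝ, 0 < C₂ ∧ ∀ r : ℝ, 0 < r → r < 1 →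
        logMean p r (canonicalProduct z s) ≤
          ENNReal.ofReal (C₂ * (Real.log (1 - r) ^ 2 + 1)))) ∧
    (s = 0 → ∀ R : Set ℝ, R ⊆ Set.Ioo 0 1 →
      (∃ q : ℝ, 0 < q ∧ q < 1 ∧ ∀ t : ℝ, 0 < t → t < 1 → ∃ r ∈ R, q * t ≤ 1 - r ∧ 1 - r ≤ t) →
      (∃ K : ℝ, ∀ p : ℝ, 1 ≤ p → ∀ r ∈ R,
        logMean p r (blaschkeProduct z) ≤ ENNReal.ofReal (K * (1 - r) ^ (γ - 1))) →
      CarlesonCondition z s γ) := by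
  refine ⟨fun hC p hp => ⟨fun _ => exists_logMean_canonicalProduct_le hz hz0 hsum hγ1 hC hp,
    fun hγ => ?_⟩, ?_⟩
  · obtain ⟨C, hC0, h⟩ := exists_logMean_canonicalProduct_le hz hz0 hsum hγ1 hC hp
    refine ⟨2 * C, by positivity, fun r hr0 hr1 => (h r hr0 hr1).trans (ENNReal.ofReal_le_ofReal ?_)⟩
    rw [hγ, add_sub_cancel_left, sub_self, Real.rpow_zero, mul_one, one_div, Real.log_inv]
    nlinarith [mul_nonneg hC0.le (sq_nonneg (Real.log (1 - r) + 1)),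
      mul_nonneg hC0.le (sq_nonneg (Real.log (1 - r)))]
  · rintro rfl R hR ⟨q, hq0, -, hq⟩ ⟨K, hK⟩
    exact carlesonCondition_of_logMean_blaschkeProduct_le hz hz0 (by simpa using hsum)
      (by simpa using hγ1) hR hq0 hq hK
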